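/- Let $1\le a\le b<N$ be integers and let $\mu_1\ge\mu_2\ge\dots\ge\mu_N>0$. An attacker and a defender play a repeated game on the locations $\{1,\dots,N\}$. In round $t$ the attacker attacks one location $I_t$ and the defender scans a set $J_t$ of $M_t$ locations, where $M_t\in\{a,\dots,b\}$ is produced by an arbitrary (possibly randomized) rule from the past; given the past and $M_t$ the two players draw independently. The attacker's reward is $r(t)=\mu_{I_t}\mathbf 1[I_t\notin J_t]$, and the defender's reward from a scanned location $j$ is $\mu_j\mathbf 1[I_t=j]$. The defender uses Exp3.M-VP with parameter $\eta=\eta_T$. It starts with weights $w_i(1)=1$. In round $t$, if $\max_j w_j(t)\ge(\frac1{M_t}-\frac{\eta}{N})\sum_i w_i(t)/(1-\eta)$, let $\kappa_t>0$ solve $\kappa_t/\big(\sum_{w_i(t)\ge\kappa_t}\kappa_t+\sum_{w_i(t)<\kappa_t}w_i(t)\big)=(\frac1{M_t}-\frac{\eta}{N})/(1-\eta)$ and put $S_0=\{i:w_i(t)\ge\kappa_t\}$, otherwise $S_0=\emptyset$ (for $\eta=1$, always $S_0=\emptyset$); put $w_i'=\kappa_t$ on $S_0$ and $w'_i=w_i(t)$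 elsewhere, and $\hat\alpha_i=M_t\big((1-\eta)w_i'/\sum_jw_j'+\eta/N\big)$. It draws $J_t$, $|J_t|=M_t$, by dependent rounding (DepRound) with marginals $\hat\alpha_i$, puts $\hat y_i=\mu_i\mathbf 1[I_t=i]/\hat\alpha_i$ for $i\in J_t$ and $\hat y_i=0$ otherwise, and sets $w_i(t+1)=w_i(t)\exp(M_t\eta\hat y_i/N)$ for $i\notin S_0$ and $w_i(t+1)=w_i(t)$ for $i\in S_0$. Exp3 with parameters $\iota>0$ and $\eta=\eta'_T$ starts with scores $s_k(1)=0$, attacks $k$ with probability $p_k=(1-\eta)(1+\iota)^{s_k(t)}/\sum_j(1+\iota)^{s_j(t)}+\eta/N$, and adds $\frac{\eta}{N}\,r(t)/p_{I_t}$ to the score of $I_t$. For the horizon $T$ the parameters are $\eta_T,\eta'_T\in(0,1]$, where $\eta_T,\eta'_T\to0$ and $T\eta_T,T\eta'_T\to\infty$ (for example, tuned proportionally to $T^{-1/2}$). Let $\bar r_\infty=\liminf_{T\to\infty}\mathbb E\big[\frac1T\sum_{t=1}^Tr(t)\big]$. For $c\in\{a,b\}$ consider the problem of maximizing $$\sum_{k=1}^N\mu_kd_k-\max_{|J|=c}\sum_{j\in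 J}\mu_jd_j$$ over all probability distributions $d$ on $\{1,\dots,N\}$; it has an optimal solution. Let $K^*$ be the number of locations in the support of any optimal solution for $c=a$, and $K^{**}$ the same number for any optimal solution for $c=b$. These numbers depend only on $\mu$, $a$, $b$ and on the chosen optimal solutions. Then: 1. $a<K^*\le N$ and $b<K^{**}\le N$. Moreover $b\le K^*\le N$ whenever $\sum_{k=1}^b(1-\mu_b/\mu_k)<a$ (for instance if $b\le a+1$, or if all $\mu_k$ are equal). 2. If the attacker uses Exp3 and the defender uses Exp3.M-VP, then $$\frac{K^*-b}{\sum_{k=1}^{K^*}1/\mu_k}\ \le\ \bar r_\infty\ \le\ \frac{K^*-a}{\sum_{k=1}^{K^*}1/\mu_k},\qquad\text{and also}\qquad \bar r_\infty\ \ge\ \frac{K^{**}-b}{\sum_{k=1}^{K^{**}}1/\mu_k}.$$ 3. The upper bound in 2 holds against Exp3.M-VP for every policy of the attacker, even if the policy depends on the horizon and on the full past of both players. -/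

import Mathlib

open Filter Topology

noncomputable section

namespace PursuitEvasion

/-- What happens in one round: the attacked location `I`, the number `M ∈ {a, …, b}` of locations
that the defender may scan, and the set `J` of scanned locations. -/
abbrev Round (N a b : ℕ) : Type := Fin N × Finset.Icc a b × Finset (Fin N)

/-- The past rounds, the most recent one first. -/
abbrev History (N a b : ℕ) : Type := List (Round N a b)

variable {N a b : ℕ}

/-- A (behaviour) policy of the attacker: the weights with which the next location is drawn, given
the past. -/
abbrev AttackPolicy (N a b : ℕ) : Type := History N a b → Fin N → ℝ

/-- The rule that determines the number of plays `M_t`: given the past, weights on `{a, …, b}`.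
Point masses give deterministic scaling functions of the past; the randomization covers any
exogenous environment. -/
abbrev ScanRule (N a b : ℕ) : Type := History N a b → Finset.Icc a b → ℝ

/-- `x_k`: it is `1` if location `k` is not scanned in the round, and `0` otherwise. -/
def notScanned (R : Round N a b) (k : Fin N) : ℝ := if k ∈ R.2.2 then 0 else 1

/-- `y_k`: it is `1` if location `k` is attacked in the round, and `0` otherwise. -/
def attacked (R : Round N a b) (k : Fin N) : ℝ := if R.1 = k then 1 else 0

/-- The attacker's reward `μ_I x_I` in one round. -/
def attackerReward (μ : Fin N → ℝ) (R : Round N a b) : ℝ := μ R.1 * notScanned R R.1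

/-! ### The defender: dependent rounding and Exp3.M-VP -/

/-- The indices with `0 < p_k < 1`. -/
def fractional (p : Fin N → ℝ) : Finset (Fin N) := by
  classical exact Finset.univ.filter fun k => 0 < p k ∧ p k < 1

/-- A rule for choosing the two distinct fractional coordinates in the loop of dependent
rounding; the algorithm leaves this choice open. -/
def IsPairRule (pick : (Fin N → ℝ) → Fin N × Fin N) : Prop :=
  ∀ p : Fin N → ℝ, 2 ≤ (fractional p).card →
    (pick p).1 ∈ fractional p ∧ (pick p).2 ∈ fractional p ∧ (pick p).1 ≠ (pick p).2

open Classical in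
/-- `depRound pick n p S` is the probability that dependent rounding, started at `p` and run for at
most `n` passes of its loop, returns `S`. Each pass makes a fractional coordinate integral, so
`n = N` passes suffice when `∑ k, p k` is an integer. -/
def depRound (pick : (Fin N → ℝ) → Fin N × Fin N) :
    ℕ → (Fin N → ℝ) → Finset (Fin N) → ℝ
  | 0, p, S => if S = Finset.univ.filter (fun k => p k = 1) then 1 else 0
  | n + 1, p, S =>
      if (fractional p).Nonempty then
        let i := (pick p).1
        let j := (pick p).2
        let ρ := min (1 - p i) (p j)
        let ζ := min (p i) (1 - p j)
        ζ / (ρ + ζ) *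
            depRound pick n (Function.update (Function.update p i (p i + ρ)) j (p j - ρ)) S
          + ρ / (ρ + ζ) *
            depRound pick n (Function.update (Function.update p i (p i - ζ)) j (p j + ζ)) S
      else if S = Finset.univ.filter (fun k => p k = 1) then 1 else 0

/-- The test of Exp3.M-VP whether some weight has to be capped,
`max_j w_j ≥ (1 / M - η / N) ∑ i, w_i / (1 - η)`, multiplied by `1 - η`. -/
def NeedsCap (η : ℝ) (M : ℕ) (w : Fin N → ℝ) : Prop :=
  ∃ j, (1 / (M : ℝ) - η / N) * ∑ i, w i ≤ (1 - η) * w j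

open Classical in
/-- The cap `κ`, the positive solution of
`κ / (∑_{w_i ≥ κ} κ + ∑_{w_i < κ} w_i) = (1 / M - η / N) / (1 - η)` (denominators cleared);
it is unique whenever it is used. -/
def cap (η : ℝ) (M : ℕ) (w : Fin N → ℝ) : ℝ :=
  Classical.epsilon fun κ : ℝ => 0 < κ ∧
    (1 - η) * κ = (1 / (M : ℝ) - η / N) * ∑ i, if κ ≤ w i then κ else w i

open Classical in
/-- The set `S₀` of capped locations. -/
def cappedSet (η : ℝ) (M : ℕ) (w : Fin N → ℝ) : Finset (Fin N) :=
  if NeedsCap η M w then Finset.univ.filter (fun i => cap η M w ≤ w i) else ∅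

/-- The modified weights `w'`. -/
def cappedWeight (η : ℝ) (M : ℕ) (w : Fin N → ℝ) (i : Fin N) : ℝ :=
  if i ∈ cappedSet η M w then cap η M w else w i

/-- The marginal probability `α̂_i` with which location `i` is scanned. -/
def scanProb (η : ℝ) (M : ℕ) (w : Fin N → ℝ) (i : Fin N) : ℝ :=
  M * ((1 - η) * (cappedWeight η M w i / ∑ j, cappedWeight η M w j) + η / N)

/-- The weights `w_i` of Exp3.M-VP after the given history; the reward of a scanned location `i` is
`μ_i y_i`, and `ŷ_i` is its importance-weighted estimate. -/
def defenderWeight (μ : Fin N → ℝ) (η : ℝ) : History N a b → Fin N → ℝ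
  | [] => fun _ => 1
  | R :: h => fun i =>
      let w := defenderWeight μ η h
      let M : ℕ := R.2.1
      let yHat := if i ∈ R.2.2 then μ i * attacked R i / scanProb η M w i else 0
      if i ∈ cappedSet η M w then w i else w i * Real.exp (M * η * yHat / N)

/-- The probability that Exp3.M-VP, allowed `M` plays after history `h`, scans the set `J`. -/
def defenderProb (pick : (Fin N → ℝ) → Fin N × Fin N) (μ : Fin N → ℝ) (η : ℝ)
    (h : History N a b) (M : ℕ) (J : Finset (Fin N)) : ℝ :=
  depRound pick N (scanProb η M (defenderWeight μ η h)) J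

/-! ### The attacker: Exp3 on top of Hedge -/

/-- The mixture `(1 - η) β_k + η / N` of the uniform distribution with the distribution `β` of
Hedge for the scores `s`. -/
def exp3Prob (ι η : ℝ) (s : Fin N → ℝ) (k : Fin N) : ℝ :=
  (1 - η) * ((1 + ι) ^ s k / ∑ j, (1 + ι) ^ s j) + η / N

/-- The scores that Hedge has accumulated from the simulated rewards. They depend on the history
only through the attacked locations and the rewards obtained there. -/
def exp3Score (μ : Fin N → ℝ) (ι η : ℝ) : History N a b → Fin N → ℝ
  | [] => fun _ => 0
  | R :: h => fun k =>
      let s := exp3Score μ ι η h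
      s k + if k = R.1 then η / N * (attackerReward μ R / exp3Prob ι η s R.1) else 0

/-- The attacker's policy Exp3. -/
def exp3 (μ : Fin N → ℝ) (ι η : ℝ) : AttackPolicy N a b :=
  fun h => exp3Prob ι η (exp3Score μ ι η h)

/-! ### The repeated game -/

/-- The probability of the next round after history `h`: given the past and `M`, the two players
draw independently. -/
def roundProb (σ : AttackPolicy N a b) (scan : ScanRule N a b)
    (defender : History N a b → ℕ → Finset (Fin N) → ℝ)
    (h : History N a b) (R : Round N a b) : ℝ :=
  σ h R.1 * scan h R.2.1 * defender h R.2.1 R.2.2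

/-- The expectation of `F` of the history of the first `T` rounds, when the next round is drawn
with the probabilities `P h`. -/
def expect (P : History N a b → Round N a b → ℝ) : ℕ → (History N a b → ℝ) → ℝ
  | 0, F => F []
  | T + 1, F => expect P T fun h => ∑ R, P h R * F (R :: h)

/-- The attacker's expected average reward over `T` rounds against Exp3.M-VP with parameter `η`. -/
def averageReward (μ : Fin N → ℝ) (scan : ScanRule N a b)
    (pick : (Fin N → ℝ) → Fin N × Fin N) (η : ℝ) (σ : AttackPolicy N a b) (T : ℕ) : ℝ :=
  expect (roundProb σ scan (defenderProb pick μ η)) T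
    (fun h => (h.map (attackerReward μ)).sum) / T

/-- The attacker's average reward over an infinite horizon,
`liminf_{T → ∞} E[(1 / T) ∑_{t ≤ T} r(t)]`; for the horizon `T` the defender uses Exp3.M-VP with
parameter `η T` and the attacker uses the policy `σ T`. -/
def longRunReward (μ : Fin N → ℝ) (scan : ScanRule N a b)
    (pick : (Fin N → ℝ) → Fin N × Fin N) (η : ℕ → ℝ) (σ : ℕ → AttackPolicy N a b) : ℝ :=
  liminf (fun T : ℕ => averageReward μ scan pick (η T) (σ T) T) atTop

/-- A parameter schedule: `η T ∈ (0, 1]` is used for the horizon `T`, with `η T → 0` and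
`T η T → ∞`. -/
def IsSchedule (η : ℕ → ℝ) : Prop :=
  (∀ T, 0 < η T ∧ η T ≤ 1) ∧ Tendsto η atTop (𝓝 0) ∧ Tendsto (fun T : ℕ => T * η T) atTop atTop

/-! ### The optimization problem -/

/-- The objective `∑ k, μ_k d_k - max_{|J| = c} ∑_{j ∈ J} μ_j d_j`. -/
def objective (μ : Fin N → ℝ) (c : ℕ) (d : Fin N → ℝ) : ℝ :=
  ∑ k, μ k * d k - ⨆ J : {J : Finset (Fin N) // J.card = c}, ∑ j ∈ J.1, μ j * d j

/-- `d` maximizes the objective over all distributions on the locations. -/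
def IsOptimal (μ : Fin N → ℝ) (c : ℕ) (d : Fin N → ℝ) : Prop :=
  d ∈ stdSimplex ℝ (Fin N) ∧ ∀ d' ∈ stdSimplex ℝ (Fin N), objective μ c d' ≤ objective μ c d

open Classical in
/-- The cardinality of the support of `d`. -/
def supportSize (d : Fin N → ℝ) : ℕ := (Finset.univ.filter fun k => 0 < d k).card

/-- `∑_{k ≤ K} 1 / μ_k`. -/
def invSum (μ : Fin N → ℝ) (K : ℕ) : ℝ :=
  ∑ k ∈ Finset.univ.filter (fun k : Fin N => (k : ℕ) < K), 1 / μ k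

end PursuitEvasion

end

/-!
The theorem rests on two regret bounds and on linear programming duality.

*The optimization problem.* Let `V` be the optimal value for budget `c`. Equalizing `μ_k d_k` over a
set `S` gives `|S| - c ≤ V ∑_{k ∈ S} 1 / μ_k` (`IsOptimal.card_sub_le`). Conversely, lowering
`μ_k d_k` uniformly on the support `S` of an optimal solution gives the reverse inequality for that
`S` (`IsOptimal.support_spec`). As `1 / μ_k` is nondecreasing, the first `|S|` locations do at least
as well as `S`, so `V = (K - c) / invSum μ K` for the support size `K` of every optimal solution
(`IsOptimal.supportSize_spec`). The numbers `β_k = (1 - V / μ_k)⁺` form a dual solution: they sum to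
at most `c`, and `μ_k (1 - β_k) ≤ V` for all `k` (`IsOptimal.exists_dual`).

*Upper bound.* Dependent rounding realizes the marginals `α` of Exp3.M-VP (`depRound_spec`), and
`α_k = 1` on capped locations (`scanProb_spec`). The potential `log ∑ w_i - ∑ (β_i / a) log w_i` is
nonnegative because `∑ β_i ≤ a`. Since the number `M` of scans is at least `a`, its expected drift
shows that the defender loses at most `O(η)` per round compared with scanning each `k` with
frequency `β_k`; this holds for every fixed attacked location and every `M`
(`defenderPotential_step`), so the attacker's policy is irrelevant. Scanning with frequencies `β`
would leave the attacker at most `V` per round, and summing the drift gives an average reward of at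
most `V + O(1 / (T η) + η)` (`expect_reward_le`).

*Lower bound.* The same argument with the potential of Hedge shows that Exp3 does as well, up to
`O(η)` per round, as any fixed mixed attack (`attackerPotential_step`). The mixed attack
proportional to `1 / μ_k` on the first `K` locations earns at least `(K - b) / invSum μ K` against
every scan of at most `b` locations (`le_expect_reward`).
-/

open Filter Topology

namespace PursuitEvasion

variable {N a b : ℕ}

/-! ### Dependent rounding -/

theorem mem_fractional {p : Fin N → ℝ} {k : Fin N} :
    k ∈ fractional p ↔ 0 < p k ∧ p k < 1 := by
  simp [fractional]

/-- One pass of dependent rounding keeps the vector in the cube, keeps its sum, and makes at least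
one of the two touched coordinates integral. -/
theorem update_pair_spec {p : Fin N → ℝ} (hp : ∀ k, 0 ≤ p k ∧ p k ≤ 1) {i j : Fin N}
    (hij : i ≠ j) (hi : i ∈ fractional p) (hj : j ∈ fractional p) {x y : ℝ}
    (hxy : x + y = p i + p j) (hx : 0 ≤ x ∧ x ≤ 1) (hy : 0 ≤ y ∧ y ≤ 1)
    (hint : (x = 0 ∨ x = 1) ∨ (y = 0 ∨ y = 1)) :
    let q := Function.update (Function.update p i x) j y
    (∀ k, 0 ≤ q k ∧ q k ≤ 1) ∧ ∑ k, q k = ∑ k, p k ∧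
      (fractional q).card < (fractional p).card := by
  intro q
  have hqi : q i = x := by simp [q, hij]
  have hqj : q j = y := by simp [q]
  have hqk : ∀ k, k ≠ i → k ≠ j → q k = p k := fun k h1 h2 => by simp [q, h1, h2]
  refine ⟨fun k => ?_, ?_, ?_⟩
  · by_cases h1 : k = i
    · subst h1; rw [hqi]; exact hx
    · by_cases h2 : k = j
      · subst h2; rw [hqj]; exact hy
      · rw [hqk k h1 h2]; exact hp k
  · have hz : ∑ k, (q k - p k) = (q i - p i) + (q j - p j) := by
      rw [← Finset.sum_pair hij (f := fun k => q k - p k)]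
      symm
      apply Finset.sum_subset (Finset.subset_univ _)
      intro k _ hk
      simp only [Finset.mem_insert, Finset.mem_singleton, not_or] at hk
      rw [hqk k hk.1 hk.2, sub_self]
    rw [Finset.sum_sub_distrib, hqi, hqj] at hz
    linarith
  · apply Finset.card_lt_card
    rw [Finset.ssubset_iff_of_subset]
    · rcases hint with h | h
      · refine ⟨i, hi, ?_⟩
        rw [mem_fractional, hqi]
        rintro ⟨h1, h2⟩
        rcases h with h | h <;> linarith
      · refine ⟨j, hj, ?_⟩
        rw [mem_fractional, hqj]
        rintro ⟨h1, h2⟩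
        rcases h with h | h <;> linarith
    · intro k hk
      by_cases h1 : k = i
      · rw [h1]; exact hi
      · by_cases h2 : k = j
        · rw [h2]; exact hj
        · rw [mem_fractional, hqk k h1 h2] at hk
          exact mem_fractional.2 hk

open Classical in
theorem depRound_of_fractional_eq_empty (pick : (Fin N → ℝ) → Fin N × Fin N) (n : ℕ)
    {p : Fin N → ℝ} (h : fractional p = ∅) (S : Finset (Fin N)) :
    depRound pick n p S = if S = Finset.univ.filter (fun k => p k = 1) then 1 else 0 := by
  cases n with
  | zero => simp [depRound]
  | succ n => simp [depRound, h]

theorem two_le_card_fractional {p : Fin N → ℝ} (hp : ∀ k, 0 ≤ p k ∧ p k ≤ 1)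
    (hsum : ∃ m : ℤ, ∑ k, p k = m) (hne : (fractional p).Nonempty) :
    2 ≤ (fractional p).card := by
  by_contra hlt
  have h1 : (fractional p).card = 1 := by have := hne.card_pos; omega
  obtain ⟨i, hi⟩ := Finset.card_eq_one.1 h1
  have hif := mem_fractional.1 (hi ▸ Finset.mem_singleton_self i : i ∈ fractional p)
  obtain ⟨m, hm⟩ := hsum
  -- all other coordinates are integral, so `p i` would be an integer in `(0, 1)`
  have hrest : ∀ k, k ≠ i → ∃ z : ℤ, p k = z := by
    intro k hk
    have hk' : k ∉ fractional p := by simp [hi, hk]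
    rw [mem_fractional] at hk'
    rcases (hp k).1.eq_or_lt with h0 | h0
    · exact ⟨0, by simp [← h0]⟩
    · exact ⟨1, by
        have : ¬ p k < 1 := fun h => hk' ⟨h0, h⟩
        push_cast
        linarith [(hp k).2]⟩
  choose! z hz using hrest
  have hs : p i = ((m - ∑ k ∈ Finset.univ.erase i, z k : ℤ) : ℝ) := by
    push_cast
    rw [← hm, ← Finset.add_sum_erase _ _ (Finset.mem_univ i),
      Finset.sum_congr rfl (fun k hk => hz k (Finset.ne_of_mem_erase hk))]
    ring
  rw [hs] at hif
  have h3 : 0 < m - ∑ k ∈ Finset.univ.erase i, z k := by exact_mod_cast hif.1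
  have h4 : m - ∑ k ∈ Finset.univ.erase i, z k < 1 := by exact_mod_cast hif.2
  omega

/-- Dependent rounding started at a vector with integral sum returns a random set with the
prescribed marginals. -/
theorem depRound_spec {pick : (Fin N → ℝ) → Fin N × Fin N} (hpick : IsPairRule pick) (n : ℕ) :
    ∀ p : Fin N → ℝ, (∀ k, 0 ≤ p k ∧ p k ≤ 1) → (∃ m : ℤ, ∑ k, p k = m) →
      (fractional p).card ≤ n →
      (∀ S, 0 ≤ depRound pick n p S) ∧ ∑ S, depRound pick n p S = 1 ∧
        ∀ i, ∑ S, (if i ∈ S then depRound pick n p S else 0) = p i := by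
  classical
  have key : ∀ (n : ℕ) (p : Fin N → ℝ), (∀ k, 0 ≤ p k ∧ p k ≤ 1) → fractional p = ∅ →
      (∀ S, 0 ≤ depRound pick n p S) ∧ ∑ S, depRound pick n p S = 1 ∧
        ∀ i, ∑ S, (if i ∈ S then depRound pick n p S else 0) = p i := by
    intro n p hp he
    simp only [depRound_of_fractional_eq_empty pick n he]
    refine ⟨fun S => by split_ifs <;> norm_num, by simp, fun i => ?_⟩
    rw [Finset.sum_eq_single (Finset.univ.filter (fun k => p k = 1))]
    · by_cases h1 : p i = 1
      · simp [h1]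
      · have hi : i ∉ fractional p := by simp [he]
        rw [mem_fractional] at hi
        have h0 : p i = 0 := by
          by_contra h0
          exact hi ⟨lt_of_le_of_ne (hp i).1 (Ne.symm h0), lt_of_le_of_ne (hp i).2 h1⟩
        simp [h0]
    · intro S _ hS
      simp [hS]
    · simp
  induction n with
  | zero =>
    intro p hp _ hc
    exact key 0 p hp (Finset.card_eq_zero.1 (Nat.le_zero.1 hc))
  | succ n ih =>
    intro p hp hsum hc
    by_cases hne : (fractional p).Nonempty
    swap
    · exact key (n + 1) p hp (Finset.not_nonempty_iff_eq_empty.1 hne)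
    obtain ⟨hi, hj, hij⟩ := hpick p (two_le_card_fractional hp hsum hne)
    set i := (pick p).1 with hidef
    set j := (pick p).2 with hjdef
    have hfi := mem_fractional.1 hi
    have hfj := mem_fractional.1 hj
    set ρ := min (1 - p i) (p j) with hρ
    set ζ := min (p i) (1 - p j) with hζ
    have hρ0 : 0 < ρ := lt_min (by linarith) hfj.1
    have hζ0 : 0 < ζ := lt_min hfi.1 (by linarith)
    have hρ1 : ρ ≤ 1 - p i := min_le_left _ _
    have hρ2 : ρ ≤ p j := min_le_right _ _
    have hζ1 : ζ ≤ p i := min_le_left _ _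
    have hζ2 : ζ ≤ 1 - p j := min_le_right _ _
    set q₁ := Function.update (Function.update p i (p i + ρ)) j (p j - ρ) with hq₁
    set q₂ := Function.update (Function.update p i (p i - ζ)) j (p j + ζ) with hq₂
    obtain ⟨hb₁, hs₁, hc₁⟩ := update_pair_spec hp hij hi hj (x := p i + ρ) (y := p j - ρ)
      (by ring) ⟨by linarith, by linarith⟩ ⟨by linarith, by linarith⟩ (by
        rcases min_choice (1 - p i) (p j) with h | h
        · exact Or.inl (Or.inr (by rw [hρ, h]; ring))
        · exact Or.inr (Or.inl (by rw [hρ, h]; ring)))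
    obtain ⟨hb₂, hs₂, hc₂⟩ := update_pair_spec hp hij hi hj (x := p i - ζ) (y := p j + ζ)
      (by ring) ⟨by linarith, by linarith⟩ ⟨by linarith, by linarith⟩ (by
        rcases min_choice (p i) (1 - p j) with h | h
        · exact Or.inl (Or.inl (by rw [hζ, h]; ring))
        · exact Or.inr (Or.inr (by rw [hζ, h]; ring)))
    obtain ⟨hn₁, ht₁, hm₁⟩ := ih q₁ hb₁ (by rw [hs₁]; exact hsum)
      (Nat.le_of_lt_succ (hc₁.trans_le hc))
    obtain ⟨hn₂, ht₂, hm₂⟩ := ih q₂ hb₂ (by rw [hs₂]; exact hsum)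
      (Nat.le_of_lt_succ (hc₂.trans_le hc))
    have hrec : ∀ S, depRound pick (n + 1) p S =
        ζ / (ρ + ζ) * depRound pick n q₁ S + ρ / (ρ + ζ) * depRound pick n q₂ S := by
      intro S
      rw [depRound, if_pos hne]
    have hpos : 0 < ρ + ζ := by linarith
    refine ⟨fun S => ?_, ?_, fun k => ?_⟩
    · rw [hrec]
      have := hn₁ S
      have := hn₂ S
      positivity
    · simp only [hrec]
      rw [Finset.sum_add_distrib, ← Finset.mul_sum, ← Finset.mul_sum, ht₁, ht₂]
      field_simp
      ring
    · have : ∀ S : Finset (Fin N), (if k ∈ S then depRound pick (n + 1) p S else 0) =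
          ζ / (ρ + ζ) * (if k ∈ S then depRound pick n q₁ S else 0)
            + ρ / (ρ + ζ) * (if k ∈ S then depRound pick n q₂ S else 0) := by
        intro S
        rw [hrec]
        split_ifs <;> simp
      simp only [this]
      rw [Finset.sum_add_distrib, ← Finset.mul_sum, ← Finset.mul_sum, hm₁, hm₂]
      by_cases h2 : k = j
      · rw [h2, hq₁, hq₂]
        simp only [Function.update_self]
        field_simp
        ring
      · by_cases h1 : k = i
        · rw [h1] at h2 ⊢
          rw [hq₁, hq₂]
          simp only [Function.update_of_ne h2, Function.update_self]
          field_simp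
          ring
        · rw [hq₁, hq₂]
          simp only [Function.update_of_ne h2, Function.update_of_ne h1]
          field_simp
          ring

/-- The expectation, under a law `q` on sets, of a quantity that depends only on whether the set
contains `k`. -/
theorem sum_mul_ite_mem {q : Finset (Fin N) → ℝ} (hq : ∑ S, q S = 1) {k : Fin N} {α : ℝ}
    (hk : ∑ S, (if k ∈ S then q S else 0) = α) (x y : ℝ) :
    ∑ S, q S * (if k ∈ S then x else y) = α * x + (1 - α) * y := by
  have : ∀ S, q S * (if k ∈ S then x else y) =
      (if k ∈ S then q S else 0) * (x - y) + q S * y := by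
    intro S; split_ifs <;> ring
  simp only [this]
  rw [Finset.sum_add_distrib, ← Finset.sum_mul, ← Finset.sum_mul, hk, hq]
  ring

/-! ### Capping the weights -/

section Cap

variable {η : ℝ} {M : ℕ} {w : Fin N → ℝ}

theorem exploration_lt (hη1 : η < 1) (hM : 1 ≤ M) (hMN : M < N) :
    η / N < 1 / (M : ℝ) := by
  have hM0 : (0 : ℝ) < M := by exact_mod_cast hM
  have hMN' : (M : ℝ) < N := by exact_mod_cast hMN
  rw [div_lt_div_iff₀ (by linarith) hM0]
  nlinarith

/-- The equation defining the cap has a solution whenever the cap is needed. -/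
theorem cap_spec (hη : 0 < η) (hη1 : η < 1) (hM : 1 ≤ M) (hMN : M < N) (hw : ∀ i, 0 < w i)
    (hcap : NeedsCap η M w) :
    0 < cap η M w ∧
      (1 - η) * cap η M w = (1 / (M : ℝ) - η / N) * ∑ i, min (cap η M w) (w i) := by
  classical
  have hθ := exploration_lt hη1 hM hMN
  have hM0 : (0 : ℝ) < M := by exact_mod_cast hM
  have hMN' : (M : ℝ) < N := by exact_mod_cast hMN
  have hN0 : (0 : ℝ) < N := by linarith
  have hex : ∃ κ : ℝ, 0 < κ ∧
      (1 - η) * κ = (1 / (M : ℝ) - η / N) * ∑ i, if κ ≤ w i then κ else w i := by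
    obtain ⟨j, hj⟩ := hcap
    obtain ⟨m, -, hm⟩ := Finset.exists_min_image Finset.univ w ⟨j, Finset.mem_univ j⟩
    obtain ⟨n, -, hn⟩ := Finset.exists_max_image Finset.univ w ⟨j, Finset.mem_univ j⟩
    set g : ℝ → ℝ := fun κ => (1 - η) * κ - (1 / (M : ℝ) - η / N) * ∑ i, min κ (w i) with hg
    have hcont : Continuous g := by
      rw [hg]; fun_prop
    have h1 : g (w m) ≤ 0 := by
      have : ∑ i, min (w m) (w i) = N * w m := by
        rw [Finset.sum_congr rfl (fun i hi => min_eq_left (hm i hi))]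
        simp
      simp only [hg, this]
      have e : (1 - η) * w m - (1 / (M : ℝ) - η / N) * (N * w m) = (1 - N / M) * w m := by
        field_simp
        ring
      rw [e]
      have : (1 : ℝ) ≤ N / M := by rw [le_div_iff₀ hM0]; linarith
      nlinarith [hw m]
    have h2 : 0 ≤ g (w n) := by
      have : ∑ i, min (w n) (w i) = ∑ i, w i :=
        Finset.sum_congr rfl (fun i hi => min_eq_right (hn i hi))
      simp only [hg, this]
      nlinarith [hn j (Finset.mem_univ j)]
    obtain ⟨κ, hκ, hκ0⟩ := intermediate_value_Icc (hm n (Finset.mem_univ n))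
      hcont.continuousOn ⟨h1, h2⟩
    refine ⟨κ, (hw m).trans_le hκ.1, ?_⟩
    simp only [hg] at hκ0
    simp only [← min_def]
    linarith
  have h := Classical.epsilon_spec hex
  refine ⟨h.1, ?_⟩
  simp only [min_def]
  exact h.2

/-- The properties of the marginals of Exp3.M-VP that its analysis uses. The last one bounds the
share of an uncapped weight in the total weight. -/
theorem scanProb_spec (hη : 0 < η) (hη1 : η < 1) (hM : 1 ≤ M) (hMN : M < N)
    (hw : ∀ i, 0 < w i) :
    (∀ i, M * (η / N) ≤ scanProb η M w i ∧ scanProb η M w i ≤ 1) ∧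
    ∑ i, scanProb η M w i = M ∧
    (∀ i ∈ cappedSet η M w, scanProb η M w i = 1) ∧
    ∀ i ∉ cappedSet η M w, M * ((1 - η) * (w i / ∑ j, w j)) ≤ scanProb η M w i := by
  classical
  have hθ := exploration_lt hη1 hM hMN
  have hM0 : (0 : ℝ) < M := by exact_mod_cast hM
  have hMN' : (M : ℝ) < N := by exact_mod_cast hMN
  have hN0 : (0 : ℝ) < N := by linarith
  have hNnat : 0 < N := by omega
  have : NeZero N := ⟨by omega⟩
  have key : (∀ i, 0 < cappedWeight η M w i) ∧ (∀ i, cappedWeight η M w i ≤ w i) ∧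
      (∀ i, (1 - η) * cappedWeight η M w i ≤
        (1 / (M : ℝ) - η / N) * ∑ j, cappedWeight η M w j) ∧
      (∀ i ∈ cappedSet η M w, (1 - η) * cappedWeight η M w i =
        (1 / (M : ℝ) - η / N) * ∑ j, cappedWeight η M w j) := by
    by_cases hcap : NeedsCap η M w
    · obtain ⟨hκ, hκe⟩ := cap_spec hη hη1 hM hMN hw hcap
      have hS : ∀ i, i ∈ cappedSet η M w ↔ cap η M w ≤ w i := by
        intro i; simp [cappedSet, hcap]
      have hmin : ∀ i, cappedWeight η M w i = min (cap η M w) (w i) := by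
        intro i; simp only [cappedWeight, hS, min_def]
      simp only [hmin]
      refine ⟨fun i => lt_min hκ (hw i), fun i => min_le_right _ _, fun i => ?_, fun i hi => ?_⟩
      · rw [← hκe]
        exact mul_le_mul_of_nonneg_left (min_le_left _ _) (by linarith)
      · rw [← hκe, min_eq_left ((hS i).1 hi)]
    · have hS : cappedSet η M w = ∅ := by simp [cappedSet, hcap]
      have hcw : cappedWeight η M w = w := by funext i; simp [cappedWeight, hS]
      simp only [hS, hcw]
      refine ⟨hw, fun i => le_rfl, fun i => ?_, by simp⟩
      by_contra hlt
      exact hcap ⟨i, (not_le.1 hlt).le⟩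
  obtain ⟨hpos, hle, hub, heq⟩ := key
  have hW : 0 < ∑ j, cappedWeight η M w j :=
    Finset.sum_pos (fun i _ => hpos i) Finset.univ_nonempty
  have hWle : ∑ j, cappedWeight η M w j ≤ ∑ j, w j := Finset.sum_le_sum fun i _ => hle i
  have e1 : (M : ℝ) * (1 / (M : ℝ) - η / N + η / N) = 1 := by field_simp; ring
  refine ⟨fun i => ⟨?_, ?_⟩, ?_, fun i hi => ?_, fun i hi => ?_⟩
  · unfold scanProb
    have : 0 ≤ (1 - η) * (cappedWeight η M w i / ∑ j, cappedWeight η M w j) :=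
      mul_nonneg (by linarith) (div_nonneg (hpos i).le hW.le)
    exact mul_le_mul_of_nonneg_left (by linarith) hM0.le
  · unfold scanProb
    refine le_of_le_of_eq (mul_le_mul_of_nonneg_left (add_le_add_left ?_ _) hM0.le) e1
    rw [← mul_div_assoc, div_le_iff₀ hW]
    exact hub i
  · unfold scanProb
    rw [← Finset.mul_sum, Finset.sum_add_distrib, ← Finset.mul_sum, ← Finset.sum_div,
      div_self hW.ne']
    simp only [Finset.sum_const, Finset.card_univ, Fintype.card_fin, nsmul_eq_mul]
    field_simp
    ring
  · unfold scanProb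
    rw [← mul_div_assoc, heq i hi, mul_div_assoc, div_self hW.ne', mul_one, e1]
  · unfold scanProb
    have hwi : cappedWeight η M w i = w i := by simp [cappedWeight, hi]
    rw [hwi]
    refine mul_le_mul_of_nonneg_left ?_ hM0.le
    have h1 : w i / ∑ j, w j ≤ w i / ∑ j, cappedWeight η M w j :=
      div_le_div_of_nonneg_left (hw i).le hW hWle
    have h2 : 0 ≤ η / N := by positivity
    have h3 := mul_le_mul_of_nonneg_left h1 (by linarith : 0 ≤ 1 - η)
    linarith

end Cap

/-- A set drawn by Exp3.M-VP has the marginals `scanProb`. -/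
theorem depRound_scanProb {pick : (Fin N → ℝ) → Fin N × Fin N} (hpick : IsPairRule pick)
    {η : ℝ} {M : ℕ} {w : Fin N → ℝ} (hη : 0 < η) (hη1 : η < 1) (hM : 1 ≤ M) (hMN : M < N)
    (hw : ∀ i, 0 < w i) :
    (∀ S, 0 ≤ depRound pick N (scanProb η M w) S) ∧
      ∑ S, depRound pick N (scanProb η M w) S = 1 ∧
      ∀ i, ∑ S, (if i ∈ S then depRound pick N (scanProb η M w) S else 0) =
        scanProb η M w i := by
  obtain ⟨h1, h2, -, -⟩ := scanProb_spec hη hη1 hM hMN hw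
  refine depRound_spec hpick N _ (fun k => ⟨le_trans (by positivity) (h1 k).1, (h1 k).2⟩)
    ⟨M, by rw [h2]; simp⟩ ?_
  exact (Finset.card_le_univ _).trans (by simp)

/-- The weights of Exp3.M-VP start at `1` and never decrease. -/
theorem one_le_defenderWeight {μ : Fin N → ℝ} (hμ : ∀ k, 0 < μ k) {η : ℝ} (hη : 0 < η)
    (hη1 : η < 1) (ha : 1 ≤ a) (hbN : b < N) (h : History N a b) (i : Fin N) :
    1 ≤ defenderWeight μ η h i := by
  induction h generalizing i with
  | nil => simp [defenderWeight]
  | cons R h ih =>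
    simp only [defenderWeight]
    have hM := Finset.mem_Icc.1 R.2.1.2
    have hα := ((scanProb_spec hη hη1 (ha.trans hM.1) (hM.2.trans_lt hbN)
      (fun k => zero_lt_one.trans_le (ih k))).1 i).1
    split_ifs with h1 h2
    · exact ih i
    · refine one_le_mul_of_one_le_of_one_le (ih i) (Real.one_le_exp ?_)
      have : 0 ≤ scanProb η R.2.1 (defenderWeight μ η h) i := le_trans (by positivity) hα
      have := (hμ i).le
      have : 0 ≤ attacked R i := by unfold attacked; split_ifs <;> norm_num
      positivity
    · simpa using ih i

/-! ### The optimization problem -/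

section Optimization

variable {μ : Fin N → ℝ} {c : ℕ} {d : Fin N → ℝ}

theorem sum_le_iSup_card (u : Fin N → ℝ) {J : Finset (Fin N)} (hJ : J.card = c) :
    ∑ j ∈ J, u j ≤ ⨆ J : {J : Finset (Fin N) // J.card = c}, ∑ j ∈ J.1, u j :=
  le_ciSup (f := fun J : {J : Finset (Fin N) // J.card = c} => ∑ j ∈ J.1, u j)
    (Set.finite_range _).bddAbove ⟨J, hJ⟩

theorem nonempty_card_eq (hc : c ≤ N) : Nonempty {J : Finset (Fin N) // J.card = c} := by
  obtain ⟨J, -, hJ⟩ := Finset.exists_subset_card_eq (s := (Finset.univ : Finset (Fin N)))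
    (n := c) (by simpa using hc)
  exact ⟨⟨J, hJ⟩⟩

theorem le_objective_iff (hc : c ≤ N) {x : ℝ} :
    x ≤ objective μ c d ↔
      ∀ J : Finset (Fin N), J.card = c → ∑ j ∈ J, μ j * d j ≤ ∑ k, μ k * d k - x := by
  have := nonempty_card_eq hc
  unfold objective
  constructor
  · intro h J hJ
    have := sum_le_iSup_card (fun j => μ j * d j) hJ
    linarith
  · intro h
    have := ciSup_le (f := fun J : {J : Finset (Fin N) // J.card = c} => ∑ j ∈ J.1, μ j * d j)
      fun J => h J.1 J.2
    linarith

theorem exists_isOptimal (μ : Fin N → ℝ) (hc : c < N) : ∃ d, IsOptimal μ c d := by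
  have : NeZero N := ⟨by omega⟩
  have hne := nonempty_card_eq hc.le
  have hcont : Continuous (objective μ c) := by
    have h2 : Continuous fun d : Fin N → ℝ =>
        ⨆ J : {J : Finset (Fin N) // J.card = c}, ∑ j ∈ J.1, μ j * d j := by
      simp only [← Finset.sup'_univ_eq_ciSup]
      refine Continuous.finset_sup'_apply Finset.univ_nonempty fun J _ => ?_
      fun_prop
    exact Continuous.sub (by fun_prop) h2
  obtain ⟨d, hd, hmax⟩ := (isCompact_stdSimplex ℝ (Fin N)).exists_isMaxOn
    ⟨_, single_mem_stdSimplex ℝ (0 : Fin N)⟩ hcont.continuousOn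
  exact ⟨d, hd, fun d' hd' => hmax hd'⟩

/-- The objective is positively homogeneous, so that the optimal value bounds it on the whole
nonnegative orthant. -/
theorem IsOptimal.objective_le (hd : IsOptimal μ c d) {x : Fin N → ℝ} (hx : ∀ k, 0 ≤ x k) :
    objective μ c x ≤ objective μ c d * ∑ k, x k := by
  rcases (Finset.sum_nonneg fun k _ => hx k : 0 ≤ ∑ k, x k).eq_or_lt with h0 | h0
  · have hz : ∀ k, x k = 0 := fun k =>
      (Finset.sum_eq_zero_iff_of_nonneg fun k _ => hx k).1 h0.symm k (Finset.mem_univ k)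
    simp [objective, hz]
  · have hmem : (fun k => (∑ k, x k)⁻¹ * x k) ∈ stdSimplex ℝ (Fin N) :=
      ⟨fun k => mul_nonneg (inv_nonneg.2 h0.le) (hx k), by
        rw [← Finset.mul_sum]; exact inv_mul_cancel₀ h0.ne'⟩
    have h := hd.2 _ hmem
    have hscale : objective μ c (fun k => (∑ k, x k)⁻¹ * x k) =
        (∑ k, x k)⁻¹ * objective μ c x := by
      unfold objective
      rw [mul_sub, Real.mul_iSup_of_nonneg (inv_nonneg.2 h0.le), Finset.mul_sum]
      congr 1
      · exact Finset.sum_congr rfl fun k _ => by ring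
      · refine iSup_congr fun J => ?_
        rw [Finset.mul_sum]
        exact Finset.sum_congr rfl fun k _ => by ring
    rw [hscale, inv_mul_le_iff₀ h0] at h
    linarith

/-- Equalizing `μ_k d_k` over a set `S` shows that the optimal value is at least
`(|S| - c) / ∑_{k ∈ S} 1 / μ_k`. -/
theorem IsOptimal.card_sub_le (hd : IsOptimal μ c d) (hμ : ∀ k, 0 < μ k) (hc : c ≤ N)
    (S : Finset (Fin N)) : (S.card : ℝ) - c ≤ objective μ c d * ∑ k ∈ S, 1 / μ k := by
  classical
  have h := hd.objective_le (x := fun k => if k ∈ S then 1 / μ k else 0) (fun k => by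
    have := hμ k
    split_ifs <;> positivity)
  have e : ∀ k, μ k * (if k ∈ S then 1 / μ k else 0) = if k ∈ S then 1 else 0 := by
    intro k
    have := (hμ k).ne'
    split_ifs
    · field_simp
    · simp
  refine le_trans ((le_objective_iff hc).2 fun J hJ => ?_) (h.trans_eq ?_)
  · simp only [e]
    have h1 : ∑ j ∈ J, (if j ∈ S then (1 : ℝ) else 0) ≤ ∑ j ∈ J, 1 :=
      Finset.sum_le_sum fun j _ => by split_ifs <;> norm_num
    simp only [Finset.sum_const, nsmul_eq_mul, mul_one, hJ] at h1
    simp only [Finset.sum_ite_mem, Finset.univ_inter, Finset.sum_const, nsmul_eq_mul, mul_one] at h1 ⊢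
    linarith
  · simp

theorem IsOptimal.objective_pos (hd : IsOptimal μ c d) (hμ : ∀ k, 0 < μ k) (hc : c < N) :
    0 < objective μ c d := by
  have h := hd.card_sub_le hμ hc.le Finset.univ
  have hc' : (c : ℝ) < N := by exact_mod_cast hc
  simp only [Finset.card_univ, Fintype.card_fin] at h
  have h0 : 0 ≤ ∑ k, 1 / μ k := Finset.sum_nonneg fun k _ => (one_div_pos.2 (hμ k)).le
  by_contra hneg
  nlinarith

/-- Lowering `μ_k d_k` by the same amount on the whole support `S` of an optimal solution costs
`|S| - c` in the objective and frees `∑_{k ∈ S} 1 / μ_k` of mass; optimality bounds the exchange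
rate. -/
theorem IsOptimal.support_spec (hd : IsOptimal μ c d) (hμ : ∀ k, 0 < μ k) (hc : c < N)
    {S : Finset (Fin N)} (hS : ∀ k, k ∈ S ↔ 0 < d k) :
    c < S.card ∧ objective μ c d * ∑ k ∈ S, 1 / μ k ≤ (S.card : ℝ) - c := by
  classical
  have hV := hd.objective_pos hμ hc
  have hd0 : ∀ k ∉ S, d k = 0 := fun k hk =>
    le_antisymm (not_lt.1 fun h => hk ((hS k).2 h)) (hd.1.1 k)
  have hdn : ∀ k, 0 ≤ μ k * d k := fun k => mul_nonneg (hμ k).le (hd.1.1 k)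
  have htot : ∑ k, μ k * d k = ∑ k ∈ S, μ k * d k := by
    symm
    exact Finset.sum_subset (Finset.subset_univ _) fun k _ hk => by rw [hd0 k hk, mul_zero]
  have hmax := (le_objective_iff (μ := μ) (d := d) hc.le).1 le_rfl
  have hcard : c < S.card := by
    by_contra hle
    obtain ⟨J, hSJ, -, hJ⟩ := Finset.exists_subsuperset_card_eq (Finset.subset_univ S)
      (not_lt.1 hle) (by simpa using hc.le)
    have h1 := hmax J hJ
    have h2 := Finset.sum_le_sum_of_subset_of_nonneg hSJ fun k _ _ => hdn k
    linarith
  refine ⟨hcard, ?_⟩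
  have hne : S.Nonempty := Finset.card_pos.1 (by omega)
  obtain ⟨m, hmS, hm⟩ := Finset.exists_min_image S (fun k => μ k * d k) hne
  set ε := μ m * d m with hε
  have hε0 : 0 < ε := mul_pos (hμ m) ((hS m).1 hmS)
  set x : Fin N → ℝ := fun k => if k ∈ S then d k - ε / μ k else 0 with hx
  have hμx : ∀ k, μ k * x k = if k ∈ S then μ k * d k - ε else 0 := by
    intro k
    have := (hμ k).ne'
    simp only [hx]
    split_ifs
    · field_simp
    · simp
  have hx0 : ∀ k, 0 ≤ μ k * x k := by
    intro k
    rw [hμx]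
    split_ifs with h
    · linarith [hm k h]
    · exact le_rfl
  have hle := hd.objective_le (x := x) fun k => nonneg_of_mul_nonneg_right (hx0 k) (hμ k)
  have hxsum : ∑ k, x k = 1 - ε * ∑ k ∈ S, 1 / μ k := by
    simp only [hx, Finset.sum_ite_mem, Finset.univ_inter, Finset.sum_sub_distrib]
    rw [Finset.mul_sum, Finset.sum_subset (Finset.subset_univ S) fun k _ hk => hd0 k hk, hd.1.2]
    congr 1
    exact Finset.sum_congr rfl fun k _ => by ring
  have hge : objective μ c d - ε * (S.card - c) ≤ objective μ c x := by
    refine (le_objective_iff hc.le).2 fun J hJ => ?_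
    have h1 : ∑ k, μ k * x k = ∑ k, μ k * d k - ε * S.card := by
      simp only [hμx, Finset.sum_ite_mem, Finset.univ_inter, Finset.sum_sub_distrib, htot]
      simp [mul_comm]
    -- a maximizing set may be moved into the support
    obtain ⟨J', hJJ', hJ'S, hJ'⟩ := Finset.exists_subsuperset_card_eq
      (Finset.inter_subset_right (s₁ := J) (s₂ := S))
      ((Finset.card_le_card Finset.inter_subset_left).trans hJ.le) hcard.le
    have h2 := hmax J' hJ'
    have h3 : ∑ j ∈ J', μ j * x j = ∑ j ∈ J', μ j * d j - ε * c := by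
      rw [Finset.sum_congr rfl fun j hj => by rw [hμx, if_pos (hJ'S hj)],
        Finset.sum_sub_distrib]
      simp [hJ', mul_comm]
    have h4 : ∑ j ∈ J, μ j * x j = ∑ j ∈ J ∩ S, μ j * x j := by
      symm
      refine Finset.sum_subset Finset.inter_subset_left fun j hj hj' => ?_
      rw [hμx, if_neg fun h => hj' (Finset.mem_inter.2 ⟨hj, h⟩)]
    have h5 := Finset.sum_le_sum_of_subset_of_nonneg hJJ' fun k _ _ => hx0 k
    linarith
  rw [hxsum] at hle
  have : ε * (objective μ c d * ∑ k ∈ S, 1 / μ k) ≤ ε * (S.card - c) := by linarith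
  exact le_of_mul_le_mul_left this hε0

/-- Among the sets of `n` locations, the first `n` have the smallest sum of `1 / μ_k`. -/
theorem invSum_card_le (hμ : ∀ k, 0 < μ k) (hanti : Antitone μ) (S : Finset (Fin N)) :
    invSum μ S.card ≤ ∑ k ∈ S, 1 / μ k := by
  have hSN : S.card ≤ N := by simpa using Finset.card_le_univ S
  set e := S.orderEmbOfFin rfl
  have h1 : ∑ k ∈ S, 1 / μ k = ∑ i, 1 / μ (e i) := by
    rw [← Finset.sum_image (f := fun k => 1 / μ k) (s := Finset.univ) (g := e)
      (fun i _ j _ h => e.injective h)]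
    congr 1
    ext k
    rw [← Finset.mem_coe, ← Finset.range_orderEmbOfFin S rfl]
    simp [e]
  have h2 : invSum μ S.card = ∑ i : Fin S.card, 1 / μ (Fin.castLE hSN i) := by
    unfold invSum
    rw [← Finset.sum_image (f := fun k => 1 / μ k) (s := Finset.univ) (g := Fin.castLE hSN)
      (fun i _ j _ h => Fin.castLE_injective hSN h)]
    congr 1
    ext k
    simp only [Finset.mem_filter, Finset.mem_univ, true_and, Finset.mem_image]
    exact ⟨fun h => ⟨⟨k, h⟩, rfl⟩, by rintro ⟨i, rfl⟩; exact i.2⟩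
  rw [h1, h2]
  refine Finset.sum_le_sum fun i _ => one_div_le_one_div_of_le (hμ _) (hanti ?_)
  have key : ∀ n (hn : n < S.card), n ≤ (e ⟨n, hn⟩ : Fin N).1 := by
    intro n
    induction n with
    | zero => intro _; exact Nat.zero_le _
    | succ n ih =>
      intro hn
      have h3 := ih (by omega)
      have h4 : e ⟨n, by omega⟩ < e ⟨n + 1, hn⟩ := e.strictMono (by simp)
      have h5 : (e ⟨n, by omega⟩ : Fin N).1 < (e ⟨n + 1, hn⟩ : Fin N).1 := h4
      omega
  exact key i.1 i.2

theorem card_filter_val_lt {K : ℕ} (hK : K ≤ N) :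
    (Finset.univ.filter fun k : Fin N => (k : ℕ) < K).card = K := by
  have : (Finset.univ.filter fun k : Fin N => (k : ℕ) < K) =
      Finset.univ.image (Fin.castLE hK) := by
    ext k
    simp only [Finset.mem_filter, Finset.mem_univ, true_and, Finset.mem_image]
    exact ⟨fun h => ⟨⟨k, h⟩, rfl⟩, by rintro ⟨i, rfl⟩; exact i.2⟩
  rw [this, Finset.card_image_of_injective _ (Fin.castLE_injective hK)]
  simp

theorem invSum_pos (hμ : ∀ k, 0 < μ k) {K : ℕ} (hK : 0 < K) (hKN : K ≤ N) : 0 < invSum μ K :=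
  Finset.sum_pos (fun k _ => one_div_pos.2 (hμ k))
    (Finset.card_pos.1 (by rw [card_filter_val_lt hKN]; exact hK))

/-- The optimal value is determined by the size of the support of any optimal solution. -/
theorem IsOptimal.supportSize_spec (hd : IsOptimal μ c d) (hμ : ∀ k, 0 < μ k)
    (hanti : Antitone μ) (hc : c < N) :
    c < supportSize d ∧ supportSize d ≤ N ∧
      objective μ c d * invSum μ (supportSize d) = supportSize d - c := by
  classical
  have hdef : supportSize d = (Finset.univ.filter fun k => 0 < d k).card := by
    unfold supportSize; congr
  obtain ⟨h1, h2⟩ := hd.support_spec hμ hc (S := Finset.univ.filter fun k => 0 < d k) (by simp)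
  have h3 := invSum_card_le hμ hanti (Finset.univ.filter fun k => 0 < d k)
  rw [← hdef] at h1 h2 h3
  have hN : supportSize d ≤ N := by
    rw [hdef]; exact (Finset.card_le_univ _).trans (by simp)
  have h4 := hd.card_sub_le hμ hc.le (Finset.univ.filter fun k : Fin N => (k : ℕ) < supportSize d)
  rw [card_filter_val_lt hN] at h4
  have h5 := mul_le_mul_of_nonneg_left h3 (hd.objective_pos hμ hc).le
  exact ⟨h1, hN, le_antisymm (h5.trans h2) h4⟩

/-- If `∑_{k ≤ n} (1 - μ_n / μ_k) < c`, the optimal value is below `μ_n`, so that enlarging an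
initial segment of fewer than `n` locations would improve on it. -/
theorem IsOptimal.le_supportSize (hd : IsOptimal μ c d) (hμ : ∀ k, 0 < μ k)
    (hanti : Antitone μ) (hc : c < N) {n : ℕ} (hn : n - 1 < N) (hnN : n ≤ N)
    (hlt : ∑ k ∈ Finset.univ.filter (fun k : Fin N => (k : ℕ) < n),
      (1 - μ ⟨n - 1, hn⟩ / μ k) < c) : n ≤ supportSize d := by
  by_contra hK
  obtain ⟨h1, h2, h3⟩ := hd.supportSize_spec hμ hanti hc
  set K := supportSize d
  set m : Fin N := ⟨n - 1, hn⟩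
  set V := objective μ c d
  have hpos := invSum_pos hμ (by omega : 0 < K) h2
  have hsub : (Finset.univ.filter fun k : Fin N => (k : ℕ) < K) ⊆
      Finset.univ.filter fun k : Fin N => (k : ℕ) < n := by
    intro k hk
    simp only [Finset.mem_filter, Finset.mem_univ, true_and] at hk ⊢
    omega
  have hle : ∀ k : Fin N, (k : ℕ) < n → μ m ≤ μ k := fun k hk =>
    hanti (by rw [Fin.le_def]; simp only [m]; omega)
  have hterm : ∀ K' ≤ N, ∑ k ∈ Finset.univ.filter (fun k : Fin N => (k : ℕ) < K'),
      (1 - μ m / μ k) = K' - μ m * invSum μ K' := by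
    intro K' hK'
    rw [Finset.sum_sub_distrib, invSum, Finset.mul_sum]
    congr 1
    · simp [card_filter_val_lt hK']
    · exact Finset.sum_congr rfl fun k _ => by ring
  have h4 := Finset.sum_le_sum_of_subset_of_nonneg hsub (f := fun k => 1 - μ m / μ k)
    fun k hk _ => sub_nonneg.2 ((div_le_one (hμ k)).2 (hle k (by simpa using hk)))
  rw [hterm n hnN] at h4 hlt
  rw [hterm K h2] at h4
  have hVm : V < μ m := by
    by_contra hge
    nlinarith
  have h5 := hd.card_sub_le hμ hc.le (Finset.univ.filter fun k : Fin N => (k : ℕ) < n)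
  rw [card_filter_val_lt hnN] at h5
  change _ ≤ V * invSum μ n at h5
  -- `K - V invSum K` increases strictly in `K` up to `n`
  have h6 : (n - K : ℝ) = ∑ k ∈ (Finset.univ.filter fun k : Fin N => (k : ℕ) < n) \
      (Finset.univ.filter fun k : Fin N => (k : ℕ) < K), 1 := by
    rw [Finset.sum_const, Finset.card_sdiff_of_subset hsub, card_filter_val_lt hnN,
      card_filter_val_lt h2, nsmul_eq_mul, mul_one, Nat.cast_sub (by omega)]
  have h7 : V * (invSum μ n - invSum μ K) = ∑ k ∈
      (Finset.univ.filter fun k : Fin N => (k : ℕ) < n) \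
      (Finset.univ.filter fun k : Fin N => (k : ℕ) < K), V / μ k := by
    rw [invSum, invSum, ← Finset.sum_sdiff hsub, add_sub_cancel_right, Finset.mul_sum]
    exact Finset.sum_congr rfl fun k _ => by ring
  have h8 : V * (invSum μ n - invSum μ K) < n - K := by
    rw [h6, h7]
    refine Finset.sum_lt_sum_of_nonempty (Finset.card_pos.1 ?_) fun k hk => ?_
    · rw [Finset.card_sdiff_of_subset hsub, card_filter_val_lt hnN, card_filter_val_lt h2]
      omega
    · simp only [Finset.mem_sdiff, Finset.mem_filter, Finset.mem_univ, true_and] at hk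
      rw [div_lt_one (hμ k)]
      exact hVm.trans_le (hle k hk.1)
  linarith

/-- The scanning frequencies `(1 - V / μ_k)⁺` of an optimal defender, where `V` is the optimal
value: they respect the scanning budget, and no location is worth more than `V` to the attacker
against them. -/
theorem IsOptimal.exists_dual (hd : IsOptimal μ c d) (hμ : ∀ k, 0 < μ k) (hc : c < N) :
    ∃ β : Fin N → ℝ, (∀ k, 0 ≤ β k) ∧ (∀ k, β k ≤ 1) ∧ ∑ k, β k ≤ c ∧
      ∀ k, μ k * (1 - β k) ≤ objective μ c d := by
  classical
  set V := objective μ c d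
  refine ⟨fun k => if V < μ k then 1 - V / μ k else 0, fun k => ?_, fun k => ?_, ?_,
    fun k => ?_⟩
  · dsimp only
    split_ifs with h
    · exact sub_nonneg.2 ((div_le_one (hμ k)).2 h.le)
    · exact le_rfl
  · have hV : 0 < V := hd.objective_pos hμ hc
    have := hμ k
    dsimp only
    split_ifs
    · have : 0 ≤ V / μ k := by positivity
      linarith
    · exact zero_le_one
  · have h := hd.card_sub_le hμ hc.le (Finset.univ.filter fun k => V < μ k)
    change _ ≤ V * _ at h
    rw [← Finset.sum_filter, Finset.sum_sub_distrib]
    have e : ∑ k ∈ Finset.univ.filter (fun k => V < μ k), V / μ k =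
        V * ∑ k ∈ Finset.univ.filter (fun k => V < μ k), 1 / μ k := by
      rw [Finset.mul_sum]
      exact Finset.sum_congr rfl fun k _ => by ring
    rw [e]
    simp only [Finset.sum_const, nsmul_eq_mul, mul_one]
    linarith
  · have := (hμ k).ne'
    dsimp only
    split_ifs with h
    · apply le_of_eq; field_simp; ring
    · linarith

end Optimization

/-! ### Expectations over histories -/

section Expect

variable {P : History N a b → Round N a b → ℝ}

theorem expect_mono (hP : ∀ h R, 0 ≤ P h R) {F G : History N a b → ℝ} (hFG : ∀ h, F h ≤ G h)
    (T : ℕ) : expect P T F ≤ expect P T G := by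
  induction T generalizing F G with
  | zero => exact hFG []
  | succ T ih =>
    exact ih fun h => Finset.sum_le_sum fun R _ => mul_le_mul_of_nonneg_left (hFG _) (hP h R)

theorem expect_add_const (hP1 : ∀ h, ∑ R, P h R = 1) (F : History N a b → ℝ) (c : ℝ) (T : ℕ) :
    expect P T (fun h => F h + c) = expect P T F + c := by
  induction T generalizing F with
  | zero => rfl
  | succ T ih =>
    simp only [expect, mul_add, Finset.sum_add_distrib, ← Finset.sum_mul, hP1, one_mul]
    exact ih _

theorem expect_neg (F : History N a b → ℝ) (T : ℕ) :
    expect P T (fun h => -F h) = -expect P T F := by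
  induction T generalizing F with
  | zero => rfl
  | succ T ih =>
    simp only [expect, mul_neg, Finset.sum_neg_distrib]
    exact ih _

/-- A nonnegative potential `Φ` that compensates the per-round gain `g` up to `c` bounds the total
expected gain. -/
theorem expect_sum_le_of_potential (hP : ∀ h R, 0 ≤ P h R) (hP1 : ∀ h, ∑ R, P h R = 1)
    {Φ : History N a b → ℝ} {g : Round N a b → ℝ} {c : ℝ} (hΦ : ∀ h, 0 ≤ Φ h)
    (hstep : ∀ h, ∑ R, P h R * (Φ (R :: h) + g R) ≤ Φ h + c) (T : ℕ) :
    expect P T (fun h => (h.map g).sum) ≤ Φ [] + T * c := by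
  refine (expect_mono hP (G := fun h => Φ h + (h.map g).sum)
    (fun h => by linarith [hΦ h]) T).trans ?_
  induction T with
  | zero => simp [expect]
  | succ T ih =>
    simp only [expect]
    refine (expect_mono hP (G := fun h => Φ h + (h.map g).sum + c) (fun h => ?_) T).trans ?_
    · have e : ∑ R, P h R * (Φ (R :: h) + ((R :: h).map g).sum) =
          ∑ R, P h R * (Φ (R :: h) + g R) + (h.map g).sum := by
        have e' : (h.map g).sum = ∑ R, P h R * (h.map g).sum := by
          rw [← Finset.sum_mul, hP1, one_mul]
        conv_rhs => rw [e']
        rw [← Finset.sum_add_distrib]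
        refine Finset.sum_congr rfl fun R _ => ?_
        rw [List.map_cons, List.sum_cons]
        ring
      rw [e]
      linarith [hstep h]
    · rw [expect_add_const hP1]
      push_cast
      linarith

end Expect

/-! ### One round of the game -/

/-- The law of a round, summed over its three coordinates. -/
theorem sum_roundProb_mul (σ : AttackPolicy N a b) (scan : ScanRule N a b)
    (D : History N a b → ℕ → Finset (Fin N) → ℝ) (h : History N a b) (F : Round N a b → ℝ) :
    ∑ R, roundProb σ scan D h R * F R =
      ∑ M : Finset.Icc a b, scan h M * ∑ i, σ h i * ∑ J, D h M J * F (i, M, J) := by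
  simp only [Fintype.sum_prod_type, roundProb]
  rw [Finset.sum_comm]
  refine Finset.sum_congr rfl fun M _ => ?_
  rw [Finset.mul_sum]
  refine Finset.sum_congr rfl fun i _ => ?_
  rw [Finset.mul_sum, Finset.mul_sum]
  exact Finset.sum_congr rfl fun J _ => by ring

theorem sum_mul_le_of_forall_le {ι : Type*} [Fintype ι] {p : ι → ℝ} (hp : p ∈ stdSimplex ℝ ι)
    {f : ι → ℝ} {c : ℝ} (hf : ∀ i, f i ≤ c) : ∑ i, p i * f i ≤ c := by
  calc ∑ i, p i * f i ≤ ∑ i, p i * c :=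
        Finset.sum_le_sum fun i _ => mul_le_mul_of_nonneg_left (hf i) (hp.1 i)
    _ = c := by rw [← Finset.sum_mul, hp.2, one_mul]

section Round

variable {μ : Fin N → ℝ} {η : ℝ} {pick : (Fin N → ℝ) → Fin N × Fin N}
  {σ : AttackPolicy N a b} {scan : ScanRule N a b}

/-- The facts about Exp3.M-VP after a given history on which both regret bounds rest. -/
theorem defenderProb_spec (hpick : IsPairRule pick) (hμ : ∀ k, 0 < μ k) (hη : 0 < η)
    (hη1 : η < 1) (ha : 1 ≤ a) (hbN : b < N) (h : History N a b) (M : Finset.Icc a b) :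
    (∀ S, 0 ≤ defenderProb pick μ η h M S) ∧
      ∑ S, defenderProb pick μ η h M S = 1 ∧
      ∀ i, ∑ S, (if i ∈ S then defenderProb pick μ η h M S else 0) =
        scanProb η M (defenderWeight μ η h) i := by
  have hM := Finset.mem_Icc.1 M.2
  exact depRound_scanProb hpick hη hη1 (ha.trans hM.1) (hM.2.trans_lt hbN)
    fun i => zero_lt_one.trans_le (one_le_defenderWeight hμ hη hη1 ha hbN h i)

theorem roundProb_spec (hσ : ∀ h, σ h ∈ stdSimplex ℝ (Fin N))
    (hscan : ∀ h, scan h ∈ stdSimplex ℝ (Finset.Icc a b)) (hpick : IsPairRule pick)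
    (hμ : ∀ k, 0 < μ k) (hη : 0 < η) (hη1 : η < 1) (ha : 1 ≤ a) (hbN : b < N) :
    (∀ h R, 0 ≤ roundProb σ scan (defenderProb pick μ η) h R) ∧
      ∀ h, ∑ R, roundProb σ scan (defenderProb pick μ η) h R = 1 := by
  constructor
  · intro h R
    exact mul_nonneg (mul_nonneg ((hσ h).1 _) ((hscan h).1 _))
      ((defenderProb_spec hpick hμ hη hη1 ha hbN h R.2.1).1 _)
  · intro h
    have e := sum_roundProb_mul σ scan (defenderProb pick μ η) h fun _ => 1
    simp only [mul_one] at e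
    rw [e]
    simp only [(defenderProb_spec hpick hμ hη hη1 ha hbN h _).2.1, mul_one, (hσ h).2,
      (hscan h).2]

theorem attackerReward_eq (μ : Fin N → ℝ) (R : Round N a b) :
    attackerReward μ R = if R.1 ∈ R.2.2 then 0 else μ R.1 := by
  unfold attackerReward notScanned
  split_ifs <;> simp

theorem exp_sub_one_le {x m : ℝ} (hx : 0 ≤ x) (hxm : x ≤ m) :
    Real.exp x - 1 ≤ x * (1 + Real.exp m * x) := by
  have h1 : Real.exp x - 1 ≤ x * Real.exp x := by
    have h := Real.add_one_le_exp (-x)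
    rw [Real.exp_neg] at h
    have hpos := Real.exp_pos x
    have := mul_le_mul_of_nonneg_left h hpos.le
    rw [mul_inv_cancel₀ hpos.ne'] at this
    linarith
  have h2 : Real.exp x ≤ Real.exp m := Real.exp_le_exp.2 hxm
  have h3 : x * Real.exp x ≤ x * Real.exp m := mul_le_mul_of_nonneg_left h2 hx
  have h4 : x * (Real.exp x - 1) ≤ x * (x * Real.exp m) :=
    mul_le_mul_of_nonneg_left (h1.trans h3) hx
  linarith

/-- The growth of the logarithm of a sum of weights when a single weight is multiplied by
`exp x`. -/
theorem log_sum_update_le {w w' : Fin N → ℝ} {i : Fin N} {x m : ℝ} (hw : ∀ k, 0 < w k)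
    (hi : w' i = w i * Real.exp x) (hk : ∀ k, k ≠ i → w' k = w k) (hx : 0 ≤ x) (hxm : x ≤ m) :
    Real.log (∑ k, w' k) - Real.log (∑ k, w k) ≤
      w i / (∑ k, w k) * (x * (1 + Real.exp m * x)) := by
  have hW : 0 < ∑ k, w k := Finset.sum_pos (fun k _ => hw k) ⟨i, Finset.mem_univ i⟩
  have hw' : ∀ k, 0 < w' k := fun k => by
    by_cases h : k = i
    · rw [h, hi]; exact mul_pos (hw i) (Real.exp_pos x)
    · rw [hk k h]; exact hw k
  have hW' : 0 < ∑ k, w' k := Finset.sum_pos (fun k _ => hw' k) ⟨i, Finset.mem_univ i⟩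
  have hsum : ∑ k, w' k = ∑ k, w k + w i * (Real.exp x - 1) := by
    rw [← Finset.add_sum_erase _ _ (Finset.mem_univ i),
      ← Finset.add_sum_erase _ w (Finset.mem_univ i), hi,
      Finset.sum_congr rfl fun k h => hk k (Finset.ne_of_mem_erase h)]
    ring
  rw [← Real.log_div hW'.ne' hW.ne']
  refine (Real.log_le_sub_one_of_pos (div_pos hW' hW)).trans ?_
  rw [hsum, add_div, div_self hW.ne', add_sub_cancel_left, mul_div_right_comm]
  exact mul_le_mul_of_nonneg_left (exp_sub_one_le hx hxm) (div_nonneg (hw i).le hW.le)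

/-! ### The regret of Exp3.M-VP -/

/-- The potential of Exp3.M-VP relative to fixed scanning frequencies `β`: the logarithm of the
total weight minus the `β`-average of the log-weights, in units of the learning rate. -/
noncomputable def defenderPotential (μ : Fin N → ℝ) (η : ℝ) (β : Fin N → ℝ) (h : History N a b) : ℝ :=
  N / η * (Real.log (∑ i, defenderWeight μ η h i)
    - ∑ i, β i / a * Real.log (defenderWeight μ η h i))

theorem defenderPotential_nonneg (hμ : ∀ k, 0 < μ k) (hη : 0 < η) (hη1 : η < 1) (ha : 1 ≤ a)
    (hab : a ≤ b) (hbN : b < N) {β : Fin N → ℝ} (hβ0 : ∀ k, 0 ≤ β k) (hβ : ∑ k, β k ≤ a)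
    (h : History N a b) : 0 ≤ defenderPotential μ η β h := by
  have ha0 : (0 : ℝ) < a := by exact_mod_cast ha
  have : NeZero N := ⟨by omega⟩
  have hw := one_le_defenderWeight hμ hη hη1 ha hbN h
  have hle : ∀ i, defenderWeight μ η h i ≤ ∑ i, defenderWeight μ η h i := fun i =>
    Finset.single_le_sum (fun k _ => zero_le_one.trans (hw k)) (Finset.mem_univ i)
  have hlog : 0 ≤ Real.log (∑ i, defenderWeight μ η h i) :=
    Real.log_nonneg ((hw 0).trans (hle 0))
  have h1 : ∑ i, β i / a * Real.log (defenderWeight μ η h i) ≤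
      ∑ i, β i / a * Real.log (∑ i, defenderWeight μ η h i) :=
    Finset.sum_le_sum fun i _ => mul_le_mul_of_nonneg_left
      (Real.log_le_log (zero_lt_one.trans_le (hw i)) (hle i)) (div_nonneg (hβ0 i) ha0.le)
  rw [← Finset.sum_mul, ← Finset.sum_div] at h1
  have h2 : (∑ k, β k) / a ≤ 1 := (div_le_one ha0).2 hβ
  have h3 := mul_le_mul_of_nonneg_right h2 hlog
  exact mul_nonneg (div_nonneg (Nat.cast_nonneg N) hη.le) (by linarith)

theorem defenderPotential_nil (μ : Fin N → ℝ) (η : ℝ) (β : Fin N → ℝ) :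
    defenderPotential μ η β ([] : History N a b) = N / η * Real.log N := by
  simp [defenderPotential, defenderWeight]

/-- Whatever location is attacked and however many locations are scanned, the expected reward of the
attacker is compensated by the potential up to `V + O(η)`, when the frequencies `β` keep every
location below `V`. -/
theorem defenderPotential_step (hpick : IsPairRule pick) (hμ : ∀ k, 0 < μ k) (hη : 0 < η)
    (hη2 : η ≤ 1 / 2) (ha : 1 ≤ a) (hbN : b < N) {β : Fin N → ℝ}
    (hβ0 : ∀ k, 0 ≤ β k) (hβ1 : ∀ k, β k ≤ 1) {V m : ℝ} (hm : ∀ k, μ k ≤ m)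
    (hV : ∀ k, μ k * (1 - β k) ≤ V) (h : History N a b) (i : Fin N) (M : Finset.Icc a b) :
    ∑ J, defenderProb pick μ η h M J *
        (defenderPotential μ η β ((i, M, J) :: h) + attackerReward μ ((i, M, J) : Round N a b)) ≤
      defenderPotential μ η β h + (V + 2 * m * (1 + m * Real.exp m) * η) := by
  have hη1 : η < 1 := by linarith
  obtain ⟨-, hD1, hDm⟩ := defenderProb_spec hpick hμ hη hη1 ha hbN h M
  have hw1 := one_le_defenderWeight hμ hη hη1 ha hbN h
  have hMab := Finset.mem_Icc.1 M.2
  have hMN : (M : ℕ) < N := hMab.2.trans_lt hbN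
  have hw : ∀ k, 0 < defenderWeight μ η h k := fun k => zero_lt_one.trans_le (hw1 k)
  obtain ⟨hαb, -, hαcap, hαun⟩ := scanProb_spec hη hη1 (ha.trans hMab.1) hMN hw
  have ha0 : (0 : ℝ) < a := by exact_mod_cast ha
  have hMa : (a : ℝ) ≤ (M : ℕ) := by exact_mod_cast hMab.1
  have hM0 : (0 : ℝ) < (M : ℕ) := by linarith
  have hN0 : (0 : ℝ) < N := by
    have : 0 < N := by omega
    exact_mod_cast this
  set w := defenderWeight μ η h with hwdef
  set α := scanProb η M w with hα
  set Φ := defenderPotential μ η β h with hΦ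
  have hαi0 : 0 < α i := lt_of_lt_of_le (by positivity) (hαb i).1
  have hμi := hμ i
  have hm0 : 0 < m := hμi.trans_le (hm i)
  have herr : 0 ≤ 2 * m * (1 + m * Real.exp m) * η := by positivity
  -- the weights change only if the attacked location is scanned and not capped
  set x : ℝ := M * η * (μ i / α i) / N with hx
  have hcons : ∀ J k, defenderWeight μ η ((i, M, J) :: h) k =
      if k = i ∧ i ∈ J ∧ i ∉ cappedSet η M w then w k * Real.exp x else w k := by
    intro J k
    simp only [defenderWeight, ← hwdef, attacked]
    by_cases hk : k = i
    · subst hk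
      by_cases h1 : k ∈ cappedSet η M w
      · simp [h1]
      · by_cases h2 : k ∈ J
        · simp [h1, h2, hx, hα]
        · simp [h1, h2]
    · simp [hk, Ne.symm hk]
  by_cases hc : i ∈ cappedSet η M w
  · have hst : ∀ J, defenderPotential μ η β ((i, M, J) :: h) = Φ := by
      intro J
      have : defenderWeight μ η ((i, M, J) :: h) = w := by
        funext k; rw [hcons]; simp [hc]
      rw [hΦ, defenderPotential, this, defenderPotential]
    have hF : ∀ J : Finset (Fin N), defenderPotential μ η β ((i, M, J) :: h) +
        attackerReward μ ((i, M, J) : Round N a b) = if i ∈ J then Φ else Φ + μ i := by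
      intro J
      rw [hst, attackerReward_eq]
      dsimp only
      split_ifs <;> ring
    simp only [hF]
    rw [sum_mul_ite_mem hD1 (hDm i), hαcap i hc]
    have : 0 ≤ V := le_trans (mul_nonneg hμi.le (by linarith [hβ1 i])) (hV i)
    linarith
  · have hx0 : 0 ≤ x := by positivity
    have hxm : x ≤ m := by
      refine le_trans ?_ (hm i)
      have h1 : x = μ i * (M * (η / N)) / α i := by rw [hx]; field_simp
      rw [h1, div_le_iff₀ hαi0]
      exact mul_le_mul_of_nonneg_left (hαb i).1 hμi.le
    have hNx : N / η * x = M * μ i / α i := by rw [hx]; field_simp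
    -- the change of the potential if the attacked location is scanned
    have hup : ∀ J, i ∈ J → defenderPotential μ η β ((i, M, J) :: h) ≤
        Φ + N / η * (w i / (∑ k, w k) * (x * (1 + Real.exp m * x)) - β i / a * x) := by
      intro J hJ
      have hi : defenderWeight μ η ((i, M, J) :: h) i = w i * Real.exp x := by
        rw [hcons, if_pos ⟨rfl, hJ, hc⟩]
      have hk : ∀ k, k ≠ i → defenderWeight μ η ((i, M, J) :: h) k = w k := fun k hk => by
        rw [hcons, if_neg fun h => hk h.1]
      have h1 := log_sum_update_le hw hi hk hx0 hxm
      have h2 : ∑ k, β k / a * Real.log (defenderWeight μ η ((i, M, J) :: h) k) =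
          ∑ k, β k / a * Real.log (w k) + β i / a * x := by
        rw [← Finset.add_sum_erase _ _ (Finset.mem_univ i),
          ← Finset.add_sum_erase _ (fun k => β k / a * Real.log (w k))
            (Finset.mem_univ i),
          hi, Real.log_mul (hw i).ne' (Real.exp_ne_zero x), Real.log_exp,
          Finset.sum_congr rfl fun k h => by rw [hk k (Finset.ne_of_mem_erase h)]]
        ring
      rw [hΦ, defenderPotential, defenderPotential, h2, ← mul_add]
      refine mul_le_mul_of_nonneg_left ?_ (div_nonneg hN0.le hη.le)
      linarith
    have hst : ∀ J, i ∉ J → defenderPotential μ η β ((i, M, J) :: h) = Φ := by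
      intro J hJ
      have : defenderWeight μ η ((i, M, J) :: h) = w := by
        funext k; rw [hcons, if_neg fun h => hJ h.2.1]
      rw [hΦ, defenderPotential, this, defenderPotential]
    have hF : ∀ J : Finset (Fin N), defenderProb pick μ η h M J *
        (defenderPotential μ η β ((i, M, J) :: h) +
          attackerReward μ ((i, M, J) : Round N a b)) ≤
        defenderProb pick μ η h M J * if i ∈ J then
          Φ + N / η * (w i / (∑ k, w k) * (x * (1 + Real.exp m * x)) - β i / a * x)
          else Φ + μ i := by
      intro J
      refine mul_le_mul_of_nonneg_left ?_
        ((defenderProb_spec hpick hμ hη hη1 ha hbN h M).1 J)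
      rw [attackerReward_eq]
      dsimp only
      split_ifs with hJ
      · linarith [hup J hJ]
      · rw [hst J hJ]
    refine (Finset.sum_le_sum fun J _ => hF J).trans ?_
    rw [sum_mul_ite_mem hD1 (hDm i)]
    set q := w i / ∑ k, w k with hq
    -- multiplied by `α i`, the importance weights cancel
    have h1 : α i * (N / η * (q * (x * (1 + Real.exp m * x)) - β i / a * x)) =
        M * μ i * (q * (1 + Real.exp m * x)) - M / a * (μ i * β i) := by
      calc _ = α i * ((N / η * x) * (q * (1 + Real.exp m * x) - β i / a)) := by ring
        _ = _ := by rw [hNx]; field_simp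
    have h2 : M * q ≤ α i * (1 + 2 * η) := by
      have h3 := hαun i hc
      have hMq : 0 ≤ M * q := by
        have : 0 ≤ q := div_nonneg (hw i).le (Finset.sum_nonneg fun k _ => (hw k).le)
        positivity
      have h1η : 1 ≤ (1 - η) * (1 + 2 * η) := by nlinarith
      have h4 : M * q ≤ (M * ((1 - η) * q)) * (1 + 2 * η) :=
        (le_mul_of_one_le_right hMq h1η).trans_eq (by ring)
      exact h4.trans (mul_le_mul_of_nonneg_right h3 (by linarith))
    have h5 : M * μ i * (q * (1 + Real.exp m * x)) ≤
        μ i * (α i * (1 + 2 * η) * (1 + Real.exp m * x)) := by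
      have : 0 ≤ 1 + Real.exp m * x := by positivity
      nlinarith [mul_le_mul_of_nonneg_right h2 (mul_nonneg hμi.le this)]
    have h6 : α i * x ≤ μ i * η := by
      have : α i * x = μ i * η * (M / N) := by rw [hx]; field_simp
      rw [this]
      refine mul_le_of_le_one_right (by positivity) ((div_le_one hN0).2 ?_)
      exact_mod_cast hMN.le
    have h7 : μ i * (α i * (1 + 2 * η) * (1 + Real.exp m * x)) ≤
        μ i * α i + 2 * m * (1 + m * Real.exp m) * η := by
      have e : μ i * (α i * (1 + 2 * η) * (1 + Real.exp m * x)) =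
          μ i * α i + μ i * (α i * (2 * η)) + μ i * ((1 + 2 * η) * (Real.exp m * (α i * x))) := by
        ring
      have h8 : μ i * (α i * (2 * η)) ≤ m * (1 * (2 * η)) := by
        gcongr
        · exact hm i
        · exact (hαb i).2
      have h9 : μ i * ((1 + 2 * η) * (Real.exp m * (α i * x))) ≤
          m * (2 * (Real.exp m * (m * η))) := by
        have h10 : α i * x ≤ m * η := h6.trans (mul_le_mul_of_nonneg_right (hm i) hη.le)
        have h11 : 0 ≤ α i * x := mul_nonneg hαi0.le hx0
        generalize α i * x = y at h10 h11
        gcongr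
        · exact hm i
        · linarith
      rw [e]
      linarith
    have h10 : μ i * β i ≤ M / a * (μ i * β i) :=
      le_mul_of_one_le_left (mul_nonneg hμi.le (hβ0 i)) ((one_le_div ha0).2 hMa)
    have h11 := hV i
    calc α i * (Φ + N / η * (q * (x * (1 + Real.exp m * x)) - β i / a * x))
          + (1 - α i) * (Φ + μ i)
        = Φ + α i * (N / η * (q * (x * (1 + Real.exp m * x)) - β i / a * x))
          + (1 - α i) * μ i := by ring
      _ ≤ _ := by rw [h1]; linarith

/-- Against Exp3.M-VP every attacker gets at most the optimal value per round, up to the regret. -/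
theorem expect_reward_le (hσ : ∀ h, σ h ∈ stdSimplex ℝ (Fin N))
    (hscan : ∀ h, scan h ∈ stdSimplex ℝ (Finset.Icc a b)) (hpick : IsPairRule pick)
    (hμ : ∀ k, 0 < μ k) (hη : 0 < η) (hη2 : η ≤ 1 / 2) (ha : 1 ≤ a) (hab : a ≤ b) (hbN : b < N)
    {d : Fin N → ℝ} (hd : IsOptimal μ a d) {m : ℝ} (hm : ∀ k, μ k ≤ m) (T : ℕ) :
    expect (roundProb σ scan (defenderProb pick μ η)) T
        (fun h => (h.map (attackerReward μ)).sum) ≤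
      N / η * Real.log N + T * (objective μ a d + 2 * m * (1 + m * Real.exp m) * η) := by
  have hη1 : η < 1 := by linarith
  obtain ⟨β, hβ0, hβ1, hβ, hV⟩ := hd.exists_dual hμ (hab.trans_lt hbN)
  obtain ⟨hP, hP1⟩ := roundProb_spec hσ hscan hpick hμ hη hη1 ha hbN
  rw [← defenderPotential_nil (a := a) (b := b) μ η β]
  refine expect_sum_le_of_potential hP hP1
    (defenderPotential_nonneg hμ hη hη1 ha hab hbN hβ0 hβ) (fun h => ?_) T
  rw [sum_roundProb_mul]
  exact sum_mul_le_of_forall_le (hscan h) fun M => sum_mul_le_of_forall_le (hσ h) fun i =>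
    defenderPotential_step hpick hμ hη hη2 ha hbN hβ0 hβ1 hm hV h i M

end Round

/-! ### The regret of Exp3 -/

section Attacker

variable {μ : Fin N → ℝ} {ι η ηD : ℝ} {pick : (Fin N → ℝ) → Fin N × Fin N}
  {scan : ScanRule N a b}

theorem exp3Prob_spec (hN : 0 < N) (hι : 0 < ι) (hη : 0 < η) (hη1 : η ≤ 1) (s : Fin N → ℝ) :
    exp3Prob ι η s ∈ stdSimplex ℝ (Fin N) ∧ (∀ k, η / N ≤ exp3Prob ι η s k) ∧
      ∀ k, (1 - η) * ((1 + ι) ^ s k / ∑ j, (1 + ι) ^ s j) ≤ exp3Prob ι η s k := by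
  have : NeZero N := ⟨by omega⟩
  have hN0 : (0 : ℝ) < N := by exact_mod_cast hN
  have hpos : ∀ k, 0 < (1 + ι) ^ s k := fun k => Real.rpow_pos_of_pos (by linarith) _
  have hW : 0 < ∑ j, (1 + ι) ^ s j := Finset.sum_pos (fun k _ => hpos k) Finset.univ_nonempty
  have h0 : ∀ k, 0 ≤ (1 - η) * ((1 + ι) ^ s k / ∑ j, (1 + ι) ^ s j) := fun k =>
    mul_nonneg (by linarith) (div_nonneg (hpos k).le hW.le)
  have h1 : 0 ≤ η / N := by positivity
  refine ⟨⟨fun k => ?_, ?_⟩, fun k => ?_, fun k => ?_⟩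
  · unfold exp3Prob; linarith [h0 k]
  · unfold exp3Prob
    rw [Finset.sum_add_distrib, ← Finset.mul_sum, ← Finset.sum_div, div_self hW.ne']
    simp only [Finset.sum_const, Finset.card_univ, Fintype.card_fin, nsmul_eq_mul]
    field_simp
    ring
  · unfold exp3Prob; linarith [h0 k]
  · unfold exp3Prob; linarith

/-- The potential of Exp3 relative to a fixed mixed attack `β`: the logarithm of the total weight
of Hedge minus the `β`-average of the log-weights, in units of the learning rate. -/
noncomputable def attackerPotential (μ : Fin N → ℝ) (ι η : ℝ) (β : Fin N → ℝ)
    (h : History N a b) : ℝ :=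
  N / (η * Real.log (1 + ι)) * (Real.log (∑ k, (1 + ι) ^ exp3Score μ ι η h k)
    - ∑ k, β k * (exp3Score μ ι η h k * Real.log (1 + ι)))

theorem attackerPotential_nil (μ : Fin N → ℝ) (ι η : ℝ) (β : Fin N → ℝ) :
    attackerPotential μ ι η β ([] : History N a b) =
      N / (η * Real.log (1 + ι)) * Real.log N := by
  simp [attackerPotential, exp3Score]

theorem attackerPotential_nonneg (hι : 0 < ι) (hη : 0 < η) {β : Fin N → ℝ}
    (hβ : β ∈ stdSimplex ℝ (Fin N)) (h : History N a b) : 0 ≤ attackerPotential μ ι η β h := by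
  have hL : 0 < Real.log (1 + ι) := Real.log_pos (by linarith)
  have hpos : ∀ k, 0 < (1 + ι) ^ exp3Score μ ι η h k := fun k =>
    Real.rpow_pos_of_pos (by linarith) _
  refine mul_nonneg (by positivity) (sub_nonneg.2 (sum_mul_le_of_forall_le hβ fun k => ?_))
  rw [← Real.log_rpow (by linarith)]
  exact Real.log_le_log (hpos k)
    (Finset.single_le_sum (fun j _ => (hpos j).le) (Finset.mem_univ k))

/-- Whatever law `D` with marginals `α` the set of scanned locations has, the regret of Exp3
relative to the mixed attack `β` is compensated by the potential up to `O(η)`. -/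
theorem attackerPotential_step (hN : 0 < N) (hι : 0 < ι) (hμ : ∀ k, 0 < μ k) (hη : 0 < η) (hη2 : η ≤ 1 / 2)
    {β : Fin N → ℝ} {m : ℝ} (hm : ∀ k, μ k ≤ m) (h : History N a b) (M : Finset.Icc a b)
    {D : Finset (Fin N) → ℝ} (hD : ∀ S, 0 ≤ D S) (hD1 : ∑ S, D S = 1) {α : Fin N → ℝ}
    (hDm : ∀ i, ∑ S, (if i ∈ S then D S else 0) = α i) (hα0 : ∀ i, 0 ≤ α i) :
    ∑ i, exp3 μ ι η h i * ∑ J, D J *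
        (attackerPotential μ ι η β ((i, M, J) :: h)
          + -attackerReward μ ((i, M, J) : Round N a b)) ≤
      attackerPotential μ ι η β h + (2 * m * (1 + Real.log (1 + ι) * m *
        Real.exp (Real.log (1 + ι) * m)) * η - ∑ i, β i * (μ i * (1 - α i))) := by
  set L := Real.log (1 + ι) with hLdef
  have hL : 0 < L := Real.log_pos (by linarith)
  have hN0 : (0 : ℝ) < N := by exact_mod_cast hN
  set s := exp3Score μ ι η h with hs
  obtain ⟨hp, hpη, hpw⟩ := exp3Prob_spec hN hι hη (by linarith : η ≤ 1) s
  have hpeq : exp3 μ ι η h = exp3Prob ι η s := rfl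
  rw [hpeq]
  set p := exp3Prob ι η s with hpdef
  set Φ := attackerPotential μ ι η β h with hΦ
  set w : Fin N → ℝ := fun k => (1 + ι) ^ s k with hw
  have hwpos : ∀ k, 0 < w k := fun k => Real.rpow_pos_of_pos (by linarith) _
  have hp0 : ∀ k, 0 < p k := fun k => lt_of_lt_of_le (by positivity) (hpη k)
  set m' := L * m with hm'
  set E := 2 * m * (1 + m' * Real.exp m') * η with hE
  have key : ∀ i, p i * ∑ J, D J * (attackerPotential μ ι η β ((i, M, J) :: h)
      + -attackerReward μ ((i, M, J) : Round N a b)) ≤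
      p i * Φ + (p i * (2 * m * η) + 2 * m' * Real.exp m' * m * η / N
        - β i * (μ i * (1 - α i))) := by
    intro i
    have hμi := hμ i
    have hpi := hp0 i
    have hm0 : 0 < m := hμi.trans_le (hm i)
    have hm'0 : 0 < m' := mul_pos hL hm0
    -- the score changes only if the attacked location is not scanned
    set X : ℝ := η / N * (μ i / p i) with hX
    have hX0 : 0 ≤ X := by positivity
    have hXm : L * X ≤ m' := by
      refine mul_le_mul_of_nonneg_left (le_trans ?_ (hm i)) hL.le
      have e : X = μ i * (η / N) / p i := by rw [hX]; ring
      rw [e, div_le_iff₀ hpi]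
      exact mul_le_mul_of_nonneg_left (hpη i) hμi.le
    have hcons : ∀ J k, exp3Score μ ι η ((i, M, J) :: h) k =
        s k + if k = i ∧ i ∉ J then X else 0 := by
      intro J k
      simp only [exp3Score, attackerReward_eq, ← hs, ← hpdef]
      by_cases hk : k = i
      · by_cases hJ : i ∈ J <;> simp [hk, hJ, hX]
      · simp [hk]
    set q := w i / ∑ k, w k with hq
    have hst : ∀ J, i ∈ J → attackerPotential μ ι η β ((i, M, J) :: h) = Φ := by
      intro J hJ
      have : exp3Score μ ι η ((i, M, J) :: h) = s := by
        funext k; rw [hcons, if_neg fun h => h.2 hJ, add_zero]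
      rw [hΦ, attackerPotential, this, attackerPotential]
    have hup : ∀ J, i ∉ J → attackerPotential μ ι η β ((i, M, J) :: h) ≤
        Φ + N / (η * L) * (q * (L * X * (1 + Real.exp m' * (L * X))) - β i * (X * L)) := by
      intro J hJ
      have hi : exp3Score μ ι η ((i, M, J) :: h) i = s i + X := by
        rw [hcons, if_pos ⟨rfl, hJ⟩]
      have hk : ∀ k, k ≠ i → exp3Score μ ι η ((i, M, J) :: h) k = s k := fun k hk => by
        rw [hcons, if_neg fun h => hk h.1, add_zero]
      have h1 := log_sum_update_le (w := w) (i := i) (x := L * X) (m := m')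
        (w' := fun k => (1 + ι) ^ exp3Score μ ι η ((i, M, J) :: h) k) hwpos
        (by simp only [hi, hw]; rw [Real.rpow_add (by linarith), Real.rpow_def_of_pos (x := 1 + ι)
              (by linarith) X])
        (fun k h => by simp only [hk k h, hw]) (by positivity) hXm
      have h2 : ∑ k, β k * (exp3Score μ ι η ((i, M, J) :: h) k * L) =
          ∑ k, β k * (s k * L) + β i * (X * L) := by
        rw [← Finset.add_sum_erase _ _ (Finset.mem_univ i),
          ← Finset.add_sum_erase _ (fun k => β k * (s k * L)) (Finset.mem_univ i),
          hi, Finset.sum_congr rfl fun k h => by rw [hk k (Finset.ne_of_mem_erase h)]]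
        ring
      rw [hΦ, attackerPotential, attackerPotential, h2, ← mul_add]
      refine mul_le_mul_of_nonneg_left ?_ (by positivity)
      linarith
    set Δ := N / (η * L) * (q * (L * X * (1 + Real.exp m' * (L * X))) - β i * (X * L)) with hΔ
    have hF : ∀ J : Finset (Fin N), D J * (attackerPotential μ ι η β ((i, M, J) :: h)
        + -attackerReward μ ((i, M, J) : Round N a b)) ≤
        D J * if i ∈ J then Φ else Φ + Δ - μ i := by
      intro J
      refine mul_le_mul_of_nonneg_left ?_ (hD J)
      rw [attackerReward_eq]
      dsimp only
      split_ifs with hJ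
      · rw [hst J hJ]; linarith
      · linarith [hup J hJ]
    have h3 := Finset.sum_le_sum fun J (_ : J ∈ Finset.univ) => hF J
    rw [sum_mul_ite_mem hD1 (hDm i)] at h3
    refine (mul_le_mul_of_nonneg_left h3 hpi.le).trans ?_
    have hα1 : α i ≤ 1 := by
      rw [← hDm i, ← hD1]
      exact Finset.sum_le_sum fun S _ => by split_ifs; exacts [le_rfl, hD S]
    -- multiplied by `p i`, the importance weights cancel
    have hpX : p i * X = η / N * μ i := by rw [hX]; field_simp
    have h4 : p i * Δ = μ i * (q * (1 + Real.exp m' * (L * X))) - β i * μ i := by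
      calc p i * Δ = N / η * (p i * X) * (q * (1 + Real.exp m' * (L * X)) - β i) := by
            rw [hΔ]; field_simp
        _ = _ := by rw [hpX]; field_simp
    have hq0 : 0 ≤ q := div_nonneg (hwpos i).le (Finset.sum_nonneg fun k _ => (hwpos k).le)
    have h5 : q ≤ p i * (1 + 2 * η) := by
      have h1η : 1 ≤ (1 - η) * (1 + 2 * η) := by nlinarith
      calc q ≤ q * ((1 - η) * (1 + 2 * η)) := le_mul_of_one_le_right hq0 h1η
        _ = (1 - η) * q * (1 + 2 * η) := by ring
        _ ≤ _ := mul_le_mul_of_nonneg_right (hpw i) (by linarith)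
    have h6 : q * (1 + Real.exp m' * (L * X)) ≤
        p i * (1 + 2 * η) + 2 * (Real.exp m' * (m' * (η / N))) := by
      have h7 : q * (1 + Real.exp m' * (L * X)) ≤
          p i * (1 + 2 * η) * (1 + Real.exp m' * (L * X)) :=
        mul_le_mul_of_nonneg_right h5 (by positivity)
      have h8 : p i * (1 + 2 * η) * (1 + Real.exp m' * (L * X)) =
          p i * (1 + 2 * η) + (1 + 2 * η) * (Real.exp m' * (L * (η / N * μ i))) := by
        rw [← hpX]; ring
      have h9 : (1 + 2 * η) * (Real.exp m' * (L * (η / N * μ i))) ≤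
          2 * (Real.exp m' * (L * (η / N * m))) := by
        gcongr
        · linarith
        · exact hm i
      rw [h8] at h7
      have h10 : L * (η / N * m) = m' * (η / N) := by rw [hm']; ring
      rw [h10] at h9
      linarith
    have h11 : p i * Δ - p i * μ i + β i * μ i ≤
        p i * (2 * m * η) + 2 * m' * Real.exp m' * m * η / N := by
      have h12 : μ i * (p i * (2 * η) + 2 * (Real.exp m' * (m' * (η / N)))) ≤
          m * (p i * (2 * η) + 2 * (Real.exp m' * (m' * (η / N)))) :=
        mul_le_mul_of_nonneg_right (hm i) (by positivity)
      have h13 := mul_le_mul_of_nonneg_left h6 hμi.le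
      have h14 : m * (p i * (2 * η) + 2 * (Real.exp m' * (m' * (η / N)))) =
          p i * (2 * m * η) + 2 * m' * Real.exp m' * m * η / N := by ring
      rw [h4]
      linarith
    have h15 : 0 ≤ p i * (2 * m * η) + 2 * m' * Real.exp m' * m * η / N := by positivity
    have h16 : (1 - α i) * (p i * Δ - p i * μ i + β i * μ i) ≤
        p i * (2 * m * η) + 2 * m' * Real.exp m' * m * η / N :=
      (mul_le_mul_of_nonneg_left h11 (by linarith)).trans
        (mul_le_of_le_one_left h15 (by linarith [hα0 i]))
    linarith
  refine (Finset.sum_le_sum fun i _ => key i).trans (le_of_eq ?_)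
  rw [Finset.sum_add_distrib, Finset.sum_sub_distrib, Finset.sum_add_distrib, ← Finset.sum_mul,
    ← Finset.sum_mul, hp.2, Finset.sum_const, Finset.card_univ, Fintype.card_fin, nsmul_eq_mul, hE]
  field_simp

/-- The mixed attack on the first `K` locations that equalizes `μ_k d_k` earns at least
`(K - b) / invSum μ K` against any scan of at most `b` locations, and Exp3 does as well up to its
regret. -/
theorem le_expect_reward (hscan : ∀ h, scan h ∈ stdSimplex ℝ (Finset.Icc a b))
    (hpick : IsPairRule pick) (hμ : ∀ k, 0 < μ k) (hηD : 0 < ηD) (hηD1 : ηD < 1) (hι : 0 < ι)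
    (hη : 0 < η) (hη2 : η ≤ 1 / 2) (ha : 1 ≤ a) (hbN : b < N) {K : ℕ} (hK : 0 < K) (hKN : K ≤ N)
    {m : ℝ} (hm : ∀ k, μ k ≤ m) (T : ℕ) :
    T * ((K - b) / invSum μ K) - (N / (η * Real.log (1 + ι)) * Real.log N
      + T * (2 * m * (1 + Real.log (1 + ι) * m * Real.exp (Real.log (1 + ι) * m)) * η)) ≤
      expect (roundProb (exp3 μ ι η) scan (defenderProb pick μ ηD)) T
        (fun h => (h.map (attackerReward μ)).sum) := by
  have hI := invSum_pos hμ hK hKN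
  set β : Fin N → ℝ := fun k => if (k : ℕ) < K then 1 / μ k / invSum μ K else 0 with hβdef
  have hβ : β ∈ stdSimplex ℝ (Fin N) := by
    refine ⟨fun k => ?_, ?_⟩
    · simp only [hβdef]
      have := hμ k
      split_ifs <;> positivity
    · simp only [hβdef]
      rw [← Finset.sum_filter, ← Finset.sum_div]
      exact div_self hI.ne'
  have hσ : ∀ h : History N a b, exp3 μ ι η h ∈ stdSimplex ℝ (Fin N) := fun h =>
    (exp3Prob_spec (by omega) hι hη (by linarith) _).1
  obtain ⟨hP, hP1⟩ := roundProb_spec hσ hscan hpick hμ hηD hηD1 ha hbN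
  set C := 2 * m * (1 + Real.log (1 + ι) * m * Real.exp (Real.log (1 + ι) * m)) with hC
  have hmain := expect_sum_le_of_potential hP hP1 (Φ := attackerPotential μ ι η β)
    (g := fun R => -attackerReward μ R) (c := C * η - (K - b) / invSum μ K)
    (attackerPotential_nonneg hι hη hβ) (fun h => ?_) T
  · rw [attackerPotential_nil] at hmain
    have e : (fun h : History N a b => (h.map fun R => -attackerReward μ R).sum) =
        fun h => -(h.map (attackerReward μ)).sum := by
      funext h
      induction h with
      | nil => simp
      | cons R h ih => rw [List.map_cons, List.sum_cons, ih, List.map_cons, List.sum_cons, neg_add]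
    rw [e, expect_neg] at hmain
    linarith
  · rw [sum_roundProb_mul]
    refine sum_mul_le_of_forall_le (hscan h) fun M => ?_
    obtain ⟨hD, hD1, hDm⟩ := defenderProb_spec hpick hμ hηD hηD1 ha hbN h M
    have hM := Finset.mem_Icc.1 M.2
    obtain ⟨hαb, hαs, -, -⟩ := scanProb_spec hηD hηD1 (ha.trans hM.1) (hM.2.trans_lt hbN)
      fun i => zero_lt_one.trans_le (one_le_defenderWeight hμ hηD hηD1 ha hbN h i)
    set α := scanProb ηD M (defenderWeight μ ηD h)
    have hα0 : ∀ i, 0 ≤ α i := fun i => le_trans (by positivity) (hαb i).1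
    refine (attackerPotential_step (by omega) hι hμ hη hη2 hm h M hD hD1 hDm hα0).trans ?_
    have h1 : ∑ i, β i * (μ i * (1 - α i)) =
        (K - ∑ i ∈ Finset.univ.filter (fun k : Fin N => (k : ℕ) < K), α i) / invSum μ K := by
      have h2 : ∀ i, β i * (μ i * (1 - α i)) =
          if (i : ℕ) < K then (1 - α i) / invSum μ K else 0 := by
        intro i
        have := (hμ i).ne'
        simp only [hβdef]
        split_ifs
        · field_simp
        · simp
      simp only [h2]
      rw [← Finset.sum_filter, ← Finset.sum_div, Finset.sum_sub_distrib, Finset.sum_const,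
        card_filter_val_lt hKN, nsmul_eq_mul, mul_one]
    have h3 : ∑ i ∈ Finset.univ.filter (fun k : Fin N => (k : ℕ) < K), α i ≤ b := by
      refine (Finset.sum_le_sum_of_subset_of_nonneg (Finset.subset_univ _)
        fun i _ _ => hα0 i).trans ?_
      rw [hαs]
      exact_mod_cast hM.2
    have h4 : ((K : ℝ) - b) / invSum μ K ≤ ∑ i, β i * (μ i * (1 - α i)) := by
      rw [h1]
      exact div_le_div_of_nonneg_right (by linarith) hI.le
    linarith

end Attacker

/-! ### The long run -/

section LongRun

theorem tendsto_regret {η : ℕ → ℝ} (hη : IsSchedule η) (x y : ℝ) :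
    Tendsto (fun T : ℕ => x / (T * η T) + y * η T) atTop (𝓝 0) := by
  simpa using (hη.2.2.const_div_atTop x).add (hη.2.1.const_mul y)

theorem IsSchedule.eventually_le {η : ℕ → ℝ} (hη : IsSchedule η) :
    ∀ᶠ T in atTop, η T ≤ 1 / 2 :=
  hη.2.1.eventually_le_const (by norm_num)

variable {μ : Fin N → ℝ} {pick : (Fin N → ℝ) → Fin N × Fin N} {scan : ScanRule N a b}
  {ηD ηA : ℕ → ℝ} {σ : ℕ → AttackPolicy N a b}

theorem averageReward_nonneg {η : ℝ} {σ : AttackPolicy N a b}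
    (hσ : ∀ h, σ h ∈ stdSimplex ℝ (Fin N))
    (hscan : ∀ h, scan h ∈ stdSimplex ℝ (Finset.Icc a b)) (hpick : IsPairRule pick)
    (hμ : ∀ k, 0 < μ k) (hη : 0 < η) (hη1 : η < 1) (ha : 1 ≤ a) (hbN : b < N) (T : ℕ) :
    0 ≤ averageReward μ scan pick η σ T := by
  have hP := (roundProb_spec hσ hscan hpick hμ hη hη1 ha hbN).1
  have h1 : ∀ T, expect (roundProb σ scan (defenderProb pick μ η)) T (fun _ => (0 : ℝ)) = 0 := by
    intro T
    induction T with
    | zero => rfl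
    | succ T ih => simpa [expect] using ih
  refine div_nonneg ?_ (Nat.cast_nonneg T)
  rw [← h1 T]
  refine expect_mono hP (fun h => List.sum_nonneg fun x hx => ?_) T
  obtain ⟨R, -, rfl⟩ := List.mem_map.1 hx
  rw [attackerReward_eq]
  split_ifs
  exacts [le_rfl, (hμ _).le]

theorem eventually_averageReward_le (hσ : ∀ T h, σ T h ∈ stdSimplex ℝ (Fin N))
    (hscan : ∀ h, scan h ∈ stdSimplex ℝ (Finset.Icc a b)) (hpick : IsPairRule pick)
    (hμ : ∀ k, 0 < μ k) (hηD : IsSchedule ηD) (ha : 1 ≤ a) (hab : a ≤ b) (hbN : b < N)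
    {d : Fin N → ℝ} (hd : IsOptimal μ a d) :
    ∃ g : ℕ → ℝ, Tendsto g atTop (𝓝 (objective μ a d)) ∧
      ∀ᶠ T in atTop, averageReward μ scan pick (ηD T) (σ T) T ≤ g T := by
  obtain ⟨m, hm⟩ : ∃ m, ∀ k, μ k ≤ m := by
    obtain ⟨m, hm⟩ := (Set.finite_range μ).bddAbove
    exact ⟨m, fun k => hm ⟨k, rfl⟩⟩
  refine ⟨fun T => objective μ a d + ((N * Real.log N) / (T * ηD T)
    + 2 * m * (1 + m * Real.exp m) * ηD T), ?_, ?_⟩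
  · simpa using (tendsto_regret hηD (N * Real.log N) (2 * m * (1 + m * Real.exp m))).const_add
      (objective μ a d)
  · filter_upwards [hηD.eventually_le, eventually_gt_atTop 0] with T hT hT0
    have hT0' : (0 : ℝ) < T := by exact_mod_cast hT0
    have hη := (hηD.1 T).1
    have h := expect_reward_le (hσ T) hscan hpick hμ hη hT ha hab hbN hd hm T
    rw [averageReward, div_le_iff₀ hT0']
    refine h.trans (le_of_eq ?_)
    field_simp
    ring

theorem longRunReward_le (hσ : ∀ T h, σ T h ∈ stdSimplex ℝ (Fin N))
    (hscan : ∀ h, scan h ∈ stdSimplex ℝ (Finset.Icc a b)) (hpick : IsPairRule pick)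
    (hμ : ∀ k, 0 < μ k) (hηD : IsSchedule ηD) (ha : 1 ≤ a) (hab : a ≤ b) (hbN : b < N)
    {d : Fin N → ℝ} (hd : IsOptimal μ a d) :
    longRunReward μ scan pick ηD σ ≤ objective μ a d := by
  obtain ⟨g, hg, hle⟩ := eventually_averageReward_le hσ hscan hpick hμ hηD ha hab hbN hd
  rw [← hg.liminf_eq]
  refine liminf_le_liminf hle ?_ hg.isBoundedUnder_le.isCoboundedUnder_ge
  refine isBoundedUnder_of_eventually_ge (a := 0) ?_
  filter_upwards [hηD.eventually_le] with T hT
  exact averageReward_nonneg (hσ T) hscan hpick hμ (hηD.1 T).1 (by linarith) ha hbN T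

theorem le_longRunReward_exp3 (hscan : ∀ h, scan h ∈ stdSimplex ℝ (Finset.Icc a b))
    (hpick : IsPairRule pick) (hμ : ∀ k, 0 < μ k) (hηD : IsSchedule ηD) (ha : 1 ≤ a)
    (hab : a ≤ b) (hbN : b < N) {ι : ℝ} (hι : 0 < ι) (hηA : IsSchedule ηA) {K : ℕ} (hK : 0 < K)
    (hKN : K ≤ N) :
    ((K : ℝ) - b) / invSum μ K ≤ longRunReward μ scan pick ηD fun T => exp3 μ ι (ηA T) := by
  have hσ : ∀ T (h : History N a b), exp3 μ ι (ηA T) h ∈ stdSimplex ℝ (Fin N) := fun T h =>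
    (exp3Prob_spec (by omega) hι (hηA.1 T).1 (hηA.1 T).2 _).1
  obtain ⟨d, hd⟩ := exists_isOptimal μ (hab.trans_lt hbN)
  obtain ⟨g, hg, hle⟩ := eventually_averageReward_le hσ hscan hpick hμ hηD ha hab hbN hd
  obtain ⟨m, hm⟩ : ∃ m, ∀ k, μ k ≤ m := by
    obtain ⟨m, hm⟩ := (Set.finite_range μ).bddAbove
    exact ⟨m, fun k => hm ⟨k, rfl⟩⟩
  set L := Real.log (1 + ι) with hLdef
  have hL : 0 < L := Real.log_pos (by linarith)
  set f : ℕ → ℝ := fun T => ((K : ℝ) - b) / invSum μ K - ((N * Real.log N / L) / (T * ηA T)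
    + 2 * m * (1 + L * m * Real.exp (L * m)) * ηA T) with hf
  have hft : Tendsto f atTop (𝓝 (((K : ℝ) - b) / invSum μ K)) := by
    simpa using (tendsto_regret hηA (N * Real.log N / L)
      (2 * m * (1 + L * m * Real.exp (L * m)))).const_sub (((K : ℝ) - b) / invSum μ K)
  rw [← hft.liminf_eq]
  refine liminf_le_liminf ?_ hft.isBoundedUnder_ge
    (IsBoundedUnder.isCoboundedUnder_ge (hg.isBoundedUnder_le.mono_le hle))
  filter_upwards [hηD.eventually_le, hηA.eventually_le, eventually_gt_atTop 0] with T hT hT' hT0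
  have hT0' : (0 : ℝ) < T := by exact_mod_cast hT0
  have hη := (hηA.1 T).1
  have h := le_expect_reward hscan hpick hμ (hηD.1 T).1 (by linarith) hι hη hT' ha hbN hK hKN
    hm T
  rw [← hLdef] at h
  rw [averageReward, le_div_iff₀ hT0']
  refine le_trans (le_of_eq ?_) h
  have hI := invSum_pos hμ hK hKN
  simp only [hf]
  field_simp

end LongRun

end PursuitEvasion

open PursuitEvasion in
theorem mainTheorem3 (N a b : ℕ) (ha : 1 ≤ a) (hab : a ≤ b) (hbN : b < N)
    (μ : Fin N → ℝ) (hμ : ∀ k, 0 < μ k) (hanti : Antitone μ) :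
    (∃ d, IsOptimal μ a d) ∧ (∃ d, IsOptimal μ b d) ∧
    ∀ d d' : Fin N → ℝ, IsOptimal μ a d → IsOptimal μ b d' →
    ∀ K K' : ℕ, K = supportSize d → K' = supportSize d' →
      (a < K ∧ K ≤ N) ∧ (b < K' ∧ K' ≤ N) ∧
      (∑ k ∈ Finset.univ.filter (fun k : Fin N => (k : ℕ) < b),
          (1 - μ ⟨b - 1, by omega⟩ / μ k) < a → b ≤ K) ∧
      ∀ (scan : ScanRule N a b) (_ : ∀ h, scan h ∈ stdSimplex ℝ (Finset.Icc a b))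
        (pick : (Fin N → ℝ) → Fin N × Fin N) (_ : IsPairRule pick)
        (ηD : ℕ → ℝ) (_ : IsSchedule ηD),
        -- the attacker plays Exp3
        (∀ (ι : ℝ) (_ : 0 < ι) (ηA : ℕ → ℝ) (_ : IsSchedule ηA),
          longRunReward μ scan pick ηD (fun T => exp3 μ ι (ηA T)) ∈
              Set.Icc (((K : ℝ) - b) / invSum μ K) (((K : ℝ) - a) / invSum μ K) ∧
          ((K' : ℝ) - b) / invSum μ K' ≤
              longRunReward μ scan pick ηD (fun T => exp3 μ ι (ηA T))) ∧
        -- the attacker plays any policy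
        (∀ σ : ℕ → AttackPolicy N a b, (∀ T h, σ T h ∈ stdSimplex ℝ (Fin N)) →
          longRunReward μ scan pick ηD σ ≤ ((K : ℝ) - a) / invSum μ K) := by
  have haN : a < N := hab.trans_lt hbN
  refine ⟨exists_isOptimal μ haN, exists_isOptimal μ hbN, ?_⟩
  rintro d d' hd hd' K K' rfl rfl
  obtain ⟨h1, h2, h3⟩ := hd.supportSize_spec hμ hanti haN
  obtain ⟨h1', h2', -⟩ := hd'.supportSize_spec hμ hanti hbN
  have hval : objective μ a d = ((supportSize d : ℝ) - a) / invSum μ (supportSize d) := by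
    rw [eq_div_iff (invSum_pos hμ (by omega) h2).ne', h3]
  refine ⟨⟨h1, h2⟩, ⟨h1', h2'⟩, hd.le_supportSize hμ hanti haN _ hbN.le, ?_⟩
  intro scan hscan pick hpick ηD hηD
  rw [← hval]
  refine ⟨fun ι hι ηA hηA => ⟨⟨?_, ?_⟩, ?_⟩, fun σ hσ => ?_⟩
  · exact le_longRunReward_exp3 hscan hpick hμ hηD ha hab hbN hι hηA (by omega) h2
  · exact longRunReward_le
      (fun T h => (exp3Prob_spec (by omega) hι (hηA.1 T).1 (hηA.1 T).2 _).1)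
      hscan hpick hμ hηD ha hab hbN hd
  · exact le_longRunReward_exp3 hscan hpick hμ hηD ha hab hbN hι hηA (by omega) h2'
  · exact longRunReward_le hσ hscan hpick hμ hηD ha hab hbN hd
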